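/- **Theorem 5.15 (geometric Sylvester criterion).** Let $1\le m\le n$, $k\ge 2$, and let $\Gamma^n\subset\mathbb R^{n+1}$ be a (nonempty) connected $C^k$-smooth hypersurface, oriented by a continuous field $\mathbf n^+$ of unit normals. *Definitions.* For a local $C^k$ parametrization $X(\theta)$ with metric tensor $g=X_\theta^TX_\theta$, $\det g\ne0$, the curvature matrix is $\mathcal K[\Gamma^n]=\tau^T\big((X_{ij},\mathbf n^+)\big)_{i,j}\,\tau$, where $\tau\tau^T=g^{-1}$; it is determined up to conjugation by an orthogonal matrix. For a symmetric matrix $S$, $T_p(S)$ is the sum of the principal minors of order $p$ ($T_0\equiv 1$), and $S$ is $m$-positive if $T_p(S)>0$ for $p=0,\dots,m$. The $p$-curvature is $\mathbf k_p[\Gamma^n]=T_p(\mathcal K[\Gamma^n])$. The hypersurface is $m$-convex at a point if its curvature matrix there is $m$-positive, and it is $m$-convex if this holds at all its points. A normal $q$-section of $\Gamma^n$ at $M\in\Gamma^n$ is the intersection of $\Gamma^n$ with a $(q+1)$-dimensional plane through $M$ spanned by $\mathbf n^+(M)$ and a $q$-dimensional subspace of the tangent plane of $\Gamma^n$ at $M$.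 Near $M$ it is a $C^k$ hypersurface of that $(q+1)$-dimensional plane, and its curvature matrix at $M$ is taken with respect to the normal $\mathbf n^+(M)$. (For $q=0$ it is, near $M$, the point $M$, with the empty curvature matrix, and it is $0$-convex.) Assume that $\mathbf k_m[\Gamma^n](M)>0$ at all points $M\in\Gamma^n$. (i) $\Gamma^n$ is $m$-convex if and only if there exist a point $M_0\in\Gamma^n$ and a normal $(n-1)$-section $\Gamma^{n-1}$ of $\Gamma^n$ at $M_0$ that is $(m-1)$-convex at $M_0$. (ii) $\Gamma^n$ is $m$-convex if and only if there exist a point $M_0\in\Gamma^n$ and a sequence $\Gamma^{n-m+1}\subset\Gamma^{n-m+2}\subset\dots\subset\Gamma^{n-1}\subset\Gamma^n$, where each $\Gamma^{n-j}$ is a normal $(n-j)$-section of $\Gamma^n$ at $M_0$, such that $$\mathbf k_{m-j}[\Gamma^{n-j}](M_0)>0,\qquad j=1,\dots,m-1.$$ Moreover, if $\Gamma^n$ is $m$-convex, then at every point $M_0\in\Gamma^n$ every normal $(n-1)$-section of $\Gamma^n$ at $M_0$ is $(m-1)$-convex at $M_0$, and the inequalities in (ii) hold for every such sequence of normal sections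 at $M_0$. -/

import Mathlib

open scoped RealInnerProductSpace

noncomputable section

/-- The `p`-trace of a square matrix: the sum of all its principal minors of order `p`
(the empty minor is `1`, so the `0`-trace is `1`). -/
def pTrace {d : ℕ} (p : ℕ) (S : Matrix (Fin d) (Fin d) ℝ) : ℝ :=
  ∑ s ∈ Finset.powersetCard p (Finset.univ : Finset (Fin d)),
    (S.submatrix (fun i : s => (i : Fin d)) (fun i : s => (i : Fin d))).det

/-- The cone of `m`-positive symmetric matrices. -/
def IsMPositive {d : ℕ} (m : ℕ) (S : Matrix (Fin d) (Fin d) ℝ) : Prop :=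
  S.IsSymm ∧ ∀ p ≤ m, 0 < pTrace p S

section Surfaces

variable {E : Type*} [NormedAddCommGroup E] [InnerProductSpace ℝ E]

/-- The partial derivative `X_i` of a map `X` of `d` real variables. -/
def coordDeriv {d : ℕ} (X : EuclideanSpace ℝ (Fin d) → E) (i : Fin d)
    (θ : EuclideanSpace ℝ (Fin d)) : E :=
  fderiv ℝ X θ (EuclideanSpace.single i 1)

/-- The metric tensor `g_{ij} = (X_i, X_j)`. -/
def metricTensor {d : ℕ} (X : EuclideanSpace ℝ (Fin d) → E) (θ : EuclideanSpace ℝ (Fin d)) :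
    Matrix (Fin d) (Fin d) ℝ :=
  Matrix.of fun i j => ⟪coordDeriv X i θ, coordDeriv X j θ⟫

/-- The matrix `b_{ij} = (X_{ij}, w)` of the second quadratic form with respect to the normal
vector `w`. -/
def secondForm {d : ℕ} (X : EuclideanSpace ℝ (Fin d) → E) (w : E)
    (θ : EuclideanSpace ℝ (Fin d)) : Matrix (Fin d) (Fin d) ℝ :=
  Matrix.of fun i j => ⟪coordDeriv (coordDeriv X i) j θ, w⟫

/-- `X`, restricted to the open set `Θ ⊆ ℝᵈ`, is a nondegenerate `C^k` local parametrization of the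
`d`-dimensional surface `Γ` in a neighbourhood of the point `M = X θ₀`: a `C^k` map with
`det g ≠ 0` which is a homeomorphism of `Θ` onto a relatively open neighbourhood of `M` in `Γ`. -/
structure IsLocalParam (k : ℕ∞) {d : ℕ} (Γ : Set E) (M : E)
    (X : EuclideanSpace ℝ (Fin d) → E) (Θ : Set (EuclideanSpace ℝ (Fin d)))
    (θ₀ : EuclideanSpace ℝ (Fin d)) : Prop where
  isOpen : IsOpen Θ
  mem : θ₀ ∈ Θ
  map_eq : X θ₀ = M
  contDiffOn : ContDiffOn ℝ k X Θ
  nondegenerate : ∀ θ ∈ Θ, (metricTensor X θ).det ≠ 0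
  isEmbedding : Topology.IsEmbedding (Θ.domRestrict X)
  image_eq : ∃ U : Set E, IsOpen U ∧ X '' Θ = Γ ∩ U

/-- A `C^k` surface of dimension `d`: a (nonempty) connected set that has a nondegenerate `C^k`
local parametrization near each of its points. It is a hypersurface if `dim E = d + 1`. -/
def IsSmoothSurface (k : ℕ∞) (d : ℕ) (Γ : Set E) : Prop :=
  IsConnected Γ ∧ ∀ M ∈ Γ, ∃ (X : EuclideanSpace ℝ (Fin d) → E)
    (Θ : Set (EuclideanSpace ℝ (Fin d))) (θ₀ : EuclideanSpace ℝ (Fin d)),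
    IsLocalParam k Γ M X Θ θ₀

/-- The (linear) tangent `d`-plane of `Γ` at `M`, spanned by the vectors `X_i`; it does not depend
on the parametrization, so all local parametrizations at `M` are admitted simultaneously. -/
def tangentPlane (k : ℕ∞) (d : ℕ) (Γ : Set E) (M : E) : Submodule ℝ E :=
  Submodule.span ℝ {v : E | ∃ (X : EuclideanSpace ℝ (Fin d) → E)
    (Θ : Set (EuclideanSpace ℝ (Fin d))) (θ₀ : EuclideanSpace ℝ (Fin d)) (i : Fin d),
    IsLocalParam k Γ M X Θ θ₀ ∧ v = coordDeriv X i θ₀}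

/-- `ν` is a continuous field of unit normals along `Γ`, that is, an orientation of a
hypersurface `Γ`. -/
structure IsUnitNormalField (k : ℕ∞) (d : ℕ) (Γ : Set E) (ν : E → E) : Prop where
  continuousOn : ContinuousOn ν Γ
  norm_eq_one : ∀ M ∈ Γ, ‖ν M‖ = 1
  inner_eq_zero : ∀ M ∈ Γ, ∀ v ∈ tangentPlane k d Γ M, ⟪v, ν M⟫ = 0

/-- `K` is one of the curvature matrices `τᵀ b τ`, where `τ τᵀ = g⁻¹`, at the point `M` of the
`d`-dimensional surface `Γ` with the unit normal `w` at `M`. The matrix `τ`, and hence `K`, is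
determined up to an orthogonal transformation. The matrix only involves scalar products of vectors
of the linear span of `w` and of the surface; therefore it is the same whether a surface that lies
in a `(d + 1)`-dimensional plane through `M` parallel to `w` is considered as a hypersurface of
this plane or as a subset of `E`. -/
def IsCurvatureMatrix (k : ℕ∞) {d : ℕ} (Γ : Set E) (w : E) (M : E)
    (K : Matrix (Fin d) (Fin d) ℝ) : Prop :=
  ∃ (X : EuclideanSpace ℝ (Fin d) → E) (Θ : Set (EuclideanSpace ℝ (Fin d)))
    (θ₀ : EuclideanSpace ℝ (Fin d)) (τ : Matrix (Fin d) (Fin d) ℝ),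
    IsLocalParam k Γ M X Θ θ₀ ∧ τ * τ.transpose = (metricTensor X θ₀)⁻¹ ∧
      K = τ.transpose * secondForm X w θ₀ * τ

open Classical in
/-- The `p`-curvature of `Γ` at `M` with respect to the unit normal `w`: the `p`-trace of the
curvature matrix. It does not depend on which of the curvature matrices is taken. (The value is `0`
if `Γ` is not a `C^k` surface of dimension `d` near `M`.) -/
def pCurvature (k : ℕ∞) (d : ℕ) (Γ : Set E) (w : E) (p : ℕ) (M : E) : ℝ :=
  if h : ∃ K : Matrix (Fin d) (Fin d) ℝ, IsCurvatureMatrix k Γ w M K then pTrace p h.choose else 0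

/-- `Γ`, with unit normal `w` at `M`, is `m`-convex at the point `M` (in particular, it is a `C^k`
surface of dimension `d` near `M`): its curvature matrix at `M` is `m`-positive. -/
def IsMConvexAt (k : ℕ∞) (d : ℕ) (Γ : Set E) (w : E) (m : ℕ) (M : E) : Prop :=
  ∃ K : Matrix (Fin d) (Fin d) ℝ, IsCurvatureMatrix k Γ w M K ∧ IsMPositive m K

/-- `Γ`, oriented by `ν`, is `m`-convex: all its points are points of `m`-convexity. -/
def IsMConvex (k : ℕ∞) (d : ℕ) (Γ : Set E) (ν : E → E) (m : ℕ) : Prop :=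
  ∀ M ∈ Γ, IsMConvexAt k d Γ (ν M) m M

/-- `S` is a normal `q`-section at `M` of the `n`-dimensional hypersurface `Γ` oriented by `ν`: the
intersection of `Γ` with the `(q + 1)`-dimensional plane through `M` that is spanned by the normal
`ν M` and a `q`-dimensional subspace `L` of the tangent plane (a `q`-direction). -/
def IsNormalSection (k : ℕ∞) (n : ℕ) (Γ : Set E) (ν : E → E) (q : ℕ) (M : E) (S : Set E) : Prop :=
  ∃ L : Submodule ℝ E, L ≤ tangentPlane k n Γ M ∧ Module.finrank ℝ L = q ∧
    S = Γ ∩ {x | x - M ∈ L ⊔ Submodule.span ℝ {ν M}}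

/-- `S r ⊆ ⋯ ⊆ S 1 ⊆ S 0 = Γ`, where `S j` is a normal `(n - j)`-section of `Γ` at `M` for
`1 ≤ j ≤ r`. -/
structure IsNormalSectionChain (k : ℕ∞) (n : ℕ) (Γ : Set E) (ν : E → E) (r : ℕ) (M : E)
    (S : ℕ → Set E) : Prop where
  zero : S 0 = Γ
  isNormalSection : ∀ j, 1 ≤ j → j ≤ r → IsNormalSection k n Γ ν (n - j) M (S j)
  subset : ∀ j, j < r → S (j + 1) ⊆ S j

end Surfaces

end

/-! Near `M` the hypersurface is a graph in the direction `ν M` of a function `φ` with `φ 0 = 0` and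
vanishing differential at `0`. Let `H` be the second derivative of `φ` at `0`. The curvature
matrices of the normal section with direction `L` have the same `p`-traces as the matrix of `H` in
any orthonormal basis of `L` (`exists_form_pCurvature_planeSection`). Completing an orthonormal
basis of a hyperplane of `L` to one of `L` makes the smaller matrix a principal submatrix of the
larger one, so at a fixed point the claim is about a symmetric matrix `S` and its principal
submatrix `S'` of order one less.

One continuity principle does the rest (`pos_of_isPreconnected_of_newton`). For symmetric matrices,
if the `(p+1)`-trace vanishes and the `(p+2)`-trace does not, then the `p`-trace and the
`(p+2)`-trace have opposite signs. Hence along a connected family with positive `m`-trace the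
`m`-positive members form a set that is open and closed.

The principle is applied to `S + s E`, with `E` the unit matrix at the corner, where the
`(p+1)`-trace grows linearly in `s` with slope the `p`-trace of `S'`. If `S'` is `(m-1)`-positive,
`S + s E` is `m`-positive for large `s`, and this descends to `s = 0`. Conversely, a first
nonpositive trace of `S'` would keep `S + s E` positive to the next order for all `s ≤ 0`, although
the trace of that order of `S + s E` vanishes at some such `s`. Applied to `Γ` itself, the principle
spreads `m`-convexity from one point to all of `Γ`. Part (ii) iterates the pointwise criterion along
the chain. -/

section PTrace

/-! ### Algebra of the `p`-traces. -/

open Polynomial in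
theorem coeff_det_one_add_X_smul_eq_pTrace {d : ℕ} (S : Matrix (Fin d) (Fin d) ℝ) (p : ℕ) :
    (Matrix.det (1 + (X : ℝ[X]) • S.map C)).coeff p = pTrace p S :=
  Matrix.coeff_det_one_add_X_smul_eq_sum_minors S p

theorem pTrace_zero {d : ℕ} (S : Matrix (Fin d) (Fin d) ℝ) : pTrace 0 S = 1 := by
  simp [pTrace]

theorem pTrace_eq_zero_of_lt {d p : ℕ} (h : d < p) (S : Matrix (Fin d) (Fin d) ℝ) :
    pTrace p S = 0 := by
  rw [pTrace, Finset.powersetCard_eq_empty.2 (by simpa using h), Finset.sum_empty]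

open Polynomial in
theorem pTrace_mul_comm {d : ℕ} (A B : Matrix (Fin d) (Fin d) ℝ) (p : ℕ) :
    pTrace p (A * B) = pTrace p (B * A) := by
  rw [← coeff_det_one_add_X_smul_eq_pTrace, ← coeff_det_one_add_X_smul_eq_pTrace,
    Matrix.map_mul, Matrix.map_mul, ← Matrix.smul_mul, Matrix.det_one_add_mul_comm,
    Matrix.mul_smul]

theorem continuous_pTrace {d : ℕ} (p : ℕ) :
    Continuous (pTrace p : Matrix (Fin d) (Fin d) ℝ → ℝ) := by
  unfold pTrace
  fun_prop

-- The perturbation changes only the first row, and the determinant is linear in that row. The extra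
-- term expands to the complementary minor.
open Polynomial in
theorem pTrace_succ_add_single {d : ℕ} (S : Matrix (Fin (d + 1)) (Fin (d + 1)) ℝ) (s : ℝ)
    (p : ℕ) :
    pTrace (p + 1) (S + Matrix.single 0 0 s) =
      pTrace (p + 1) S + s * pTrace p (S.submatrix Fin.succ Fin.succ) := by
  have key : Matrix.det (1 + (X : ℝ[X]) • (S + Matrix.single 0 0 s).map C) =
      Matrix.det (1 + (X : ℝ[X]) • S.map C) +
        X * (C s * Matrix.det (1 + (X : ℝ[X]) • (S.submatrix Fin.succ Fin.succ).map C)) := by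
    set N : Matrix (Fin (d + 1)) (Fin (d + 1)) ℝ[X] := 1 + (X : ℝ[X]) • S.map C with hN
    have h1 : (1 + (X : ℝ[X]) • (S + Matrix.single 0 0 s).map C) =
        N.updateRow 0 (N 0 + (X * C s) • Pi.single 0 1) := by
      ext1 i j
      refine Fin.cases ?_ (fun i => ?_) i
      · refine Fin.cases ?_ (fun j => ?_) j
        · simp [hN, mul_add, add_assoc]
        · simp [hN, (Fin.succ_ne_zero j).symm]
      · simp [hN, (Fin.succ_ne_zero i).symm]
    have h2 : (N.updateRow 0 (Pi.single 0 1)).det =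
        Matrix.det (1 + (X : ℝ[X]) • (S.submatrix Fin.succ Fin.succ).map C) := by
      rw [Matrix.det_succ_row_zero, Fin.sum_univ_succ]
      simp only [Matrix.updateRow_self, Pi.single_eq_same, Fin.succ_ne_zero, ne_eq,
        not_false_eq_true, Pi.single_eq_of_ne, mul_zero, zero_mul, Finset.sum_const_zero,
        add_zero, Fin.val_zero, pow_zero, one_mul, Fin.succAbove_zero]
      congr 1
      ext1 i j
      simp [hN, Matrix.one_apply]
    rw [h1, Matrix.det_updateRow_add, Matrix.updateRow_eq_self, Matrix.det_updateRow_smul, h2,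
      mul_assoc]
  have := congrArg (fun f => f.coeff (p + 1)) key
  simpa [coeff_det_one_add_X_smul_eq_pTrace] using this

end PTrace

/-! ### Newton's inequality through real-rooted polynomials. -/

section Newton

open Polynomial

/-- Rolle: the derivative has at least `deg f - 1` roots with multiplicity, which already exhausts
its degree. -/
theorem Polynomial.Splits.derivative_real {f : ℝ[X]} (hf : f.Splits) : f.derivative.Splits := by
  rw [splits_iff_card_roots] at hf ⊢
  have h1 := card_roots_le_derivative f
  have h2 := f.derivative.card_roots'
  have h3 := natDegree_derivative_le f
  omega

theorem Polynomial.Splits.iterate_derivative_real {f : ℝ[X]} (hf : f.Splits) (k : ℕ) :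
    (derivative^[k] f).Splits := by
  induction k with
  | zero => exact hf
  | succ k ih => rw [Function.iterate_succ_apply']; exact ih.derivative_real

/-- For a monic split polynomial with nonzero roots, `c₁² - 2c₀c₂` is `c₀²` times the sum of the
inverse squares of the roots. This recursion proves its nonnegativity without dividing by roots. -/
theorem two_mul_coeff_zero_mul_coeff_two_X_sub_C_mul_eq (a : ℝ) (g : ℝ[X]) :
    ((X - C a) * g).coeff 1 ^ 2 - 2 * (((X - C a) * g).coeff 0 * ((X - C a) * g).coeff 2) =
      g.coeff 0 ^ 2 + a ^ 2 * (g.coeff 1 ^ 2 - 2 * (g.coeff 0 * g.coeff 2)) := by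
  have h0 : ((X - C a) * g).coeff 0 = -a * g.coeff 0 := by simp [sub_mul]
  have h1 : ((X - C a) * g).coeff 1 = g.coeff 0 - a * g.coeff 1 := by
    simp [sub_mul, coeff_X_mul (n := 0)]
  have h2 : ((X - C a) * g).coeff 2 = g.coeff 1 - a * g.coeff 2 := by
    simp [sub_mul, coeff_X_mul (n := 1)]
  rw [h0, h1, h2]
  ring

theorem two_mul_coeff_zero_mul_coeff_two_prod_le (s : Multiset ℝ) :
    0 ≤ (s.map fun a => X - C a).prod.coeff 1 ^ 2 - 2 * ((s.map fun a => X - C a).prod.coeff 0 *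
      (s.map fun a => X - C a).prod.coeff 2) := by
  induction s using Multiset.induction_on with
  | empty => simp [coeff_one]
  | cons a s ih =>
    rw [Multiset.map_cons, Multiset.prod_cons, two_mul_coeff_zero_mul_coeff_two_X_sub_C_mul_eq]
    positivity

theorem Polynomial.Splits.two_mul_coeff_zero_mul_coeff_two_lt {f : ℝ[X]} (hf : f.Splits)
    (hd : f.natDegree ≠ 0) (h0 : f.coeff 0 ≠ 0) :
    2 * (f.coeff 0 * f.coeff 2) < f.coeff 1 ^ 2 := by
  obtain ⟨a, s, hs⟩ : ∃ a s, f.roots = a ::ₘ s := by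
    obtain ⟨a, ha⟩ := Multiset.card_pos_iff_exists_mem.1
      (Nat.pos_of_ne_zero (splits_iff_card_roots.1 hf ▸ hd))
    exact ⟨a, Multiset.exists_cons_of_mem ha⟩
  have hprod := hf.eq_prod_roots
  rw [hs, Multiset.map_cons, Multiset.prod_cons] at hprod
  generalize f.leadingCoeff = c at hprod
  have hle := two_mul_coeff_zero_mul_coeff_two_prod_le s
  generalize (s.map fun a => X - C a).prod = g at hprod hle
  have hid := two_mul_coeff_zero_mul_coeff_two_X_sub_C_mul_eq a g
  have hg : g.coeff 0 ≠ 0 := by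
    rintro hg
    exact h0 (by rw [hprod, mul_coeff_zero, mul_coeff_zero, hg]; simp)
  have hc : c ≠ 0 := by
    rintro rfl
    exact h0 (by rw [hprod]; simp)
  rw [hprod]
  simp only [coeff_C_mul]
  generalize (X - C a) * g = G at hid
  -- Strictness comes from the split-off root: it contributes the square of `g.coeff 0 ≠ 0`.
  have h1 : 0 < G.coeff 1 ^ 2 - 2 * (G.coeff 0 * G.coeff 2) := by
    rw [hid]; positivity
  nlinarith [mul_pos (by positivity : 0 < c ^ 2) h1]

/-- The `k`-th derivative still splits and carries the coefficients `k`, `k + 1`, `k + 2` to `0`,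
`1`, `2` with positive factors. -/
theorem Polynomial.Splits.coeff_mul_coeff_neg {f : ℝ[X]} (hf : f.Splits) {k : ℕ}
    (hd : k < f.natDegree) (h0 : f.coeff k ≠ 0) (hk : f.coeff (k + 1) = 0) :
    f.coeff k * f.coeff (k + 2) < 0 := by
  have p1 : (0 : ℝ) < k.descFactorial k := by
    exact_mod_cast Nat.descFactorial_pos.2 le_rfl
  have p2 : (0 : ℝ) < (k + 2).descFactorial k := by
    exact_mod_cast Nat.descFactorial_pos.2 (by omega)
  have hdeg : (derivative^[k] f).natDegree ≠ 0 := by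
    have hc : (derivative^[k] f).coeff (f.natDegree - k) ≠ 0 := by
      rw [coeff_iterate_derivative, Nat.sub_add_cancel hd.le, nsmul_eq_mul]
      refine mul_ne_zero ?_ (leadingCoeff_ne_zero.2 fun hf0 => h0 (by simp [hf0]))
      exact_mod_cast (Nat.descFactorial_pos.2 hd.le).ne'
    have := le_natDegree_of_ne_zero hc
    omega
  have h := (hf.iterate_derivative_real k).two_mul_coeff_zero_mul_coeff_two_lt hdeg
  rw [coeff_iterate_derivative, coeff_iterate_derivative, coeff_iterate_derivative,
    zero_add, add_comm 1 k, hk, add_comm 2 k] at h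
  simp only [nsmul_eq_mul, mul_zero] at h
  have h' := h (mul_ne_zero p1.ne' h0)
  by_contra hc
  push Not at hc
  nlinarith [mul_nonneg (mul_pos p1 p2).le hc]

/-- Newton's inequality at a zero of the sequence of the `p`-traces. -/
theorem pTrace_mul_pTrace_neg {d : ℕ} {S : Matrix (Fin d) (Fin d) ℝ} (hS : S.IsSymm)
    {p : ℕ} (h : pTrace (p + 1) S = 0) (h' : pTrace (p + 2) S ≠ 0) :
    pTrace p S * pTrace (p + 2) S < 0 := by
  have hd : p + 2 ≤ d := by
    by_contra hd
    exact h' (pTrace_eq_zero_of_lt (not_le.1 hd) S)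
  have hH : S.IsHermitian := by
    rw [Matrix.IsHermitian, Matrix.conjTranspose_eq_transpose_of_trivial]; exact hS
  have hc : ∀ q ≤ d, S.charpoly.coeff (d - q) = (-1) ^ q * pTrace q S := by
    intro q hq
    have := Matrix.charpoly_coeff_eq_sum_minors S q (by simpa using hq)
    rwa [Fintype.card_fin] at this
  have hdeg : S.charpoly.natDegree = d := by simp
  obtain ⟨e, rfl⟩ := Nat.exists_eq_add_of_le' hd
  have h0 := hc (p + 2) (by omega)
  have h1 := hc (p + 1) (by omega)
  have h2 := hc p (by omega)
  rw [show e + (p + 2) - (p + 2) = e by omega] at h0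
  rw [show e + (p + 2) - (p + 1) = e + 1 by omega, h, mul_zero] at h1
  rw [show e + (p + 2) - p = e + 2 by omega] at h2
  -- The coefficients at `e`, `e + 1`, `e + 2` are, up to sign, the traces of order `p + 2`, `p +
  -- 1`, `p`. The two outer signs agree.
  have hn := hH.splits_charpoly.coeff_mul_coeff_neg (k := e) (by omega)
    (by rw [h0]; exact mul_ne_zero (by simp) h') h1
  rw [h0, h2] at hn
  have : ((-1 : ℝ) ^ p) * (-1) ^ p = 1 := by rw [← mul_pow]; simp
  calc pTrace p S * pTrace (p + 2) S
      = ((-1 : ℝ) ^ p * (-1) ^ p) * (pTrace p S * pTrace (p + 2) S) := by rw [this, one_mul]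
    _ = (-1) ^ (p + 2) * pTrace (p + 2) S * ((-1) ^ p * pTrace p S) := by ring
    _ < 0 := hn

end Newton

/-! ### Propagation of positivity over a connected set. -/

section Connected

/-- A sequence which is nonnegative up to `m`, positive at `m`, and satisfies the
sign condition of Newton at its zeros is positive up to `m`. -/
theorem pos_of_nonneg_of_newton {f : ℕ → ℝ} {m : ℕ} (h0 : f 0 = 1) (hm : 0 < f m)
    (hnewton : ∀ p, f (p + 1) = 0 → f (p + 2) ≠ 0 → f p * f (p + 2) < 0)
    (hnn : ∀ p ≤ m, 0 ≤ f p) : ∀ p ≤ m, 0 < f p := by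
  intro p hp
  -- Going down from `m`, the value at `p + 2` is already positive, so a zero at `p + 1` would force
  -- `f p < 0`.
  induction hp using Nat.decreasingInduction with
  | self => exact hm
  | of_succ p hp ih =>
    rcases p with _ | p
    · rw [h0]; exact one_pos
    · refine (hnn _ hp.le).lt_of_ne' fun hz => ?_
      exact absurd (hnewton p hz ih.ne')
        (not_lt.2 (mul_nonneg (hnn p (by omega)) ih.le))

/-- The strict inequalities cut out the same set as the weak ones, so this set is both open and
closed in `s`. -/
theorem pos_of_isPreconnected_of_newton {α : Type*} [TopologicalSpace α] {s : Set α}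
    (hs : IsPreconnected s) {f : ℕ → α → ℝ} {m : ℕ} (hf : ∀ p ≤ m, ContinuousOn (f p) s)
    (h0 : ∀ x ∈ s, f 0 x = 1) (hm : ∀ x ∈ s, 0 < f m x)
    (hnewton : ∀ x ∈ s, ∀ p, f (p + 1) x = 0 → f (p + 2) x ≠ 0 → f p x * f (p + 2) x < 0)
    {x₀ : α} (hx₀ : x₀ ∈ s) (hpos : ∀ p ≤ m, 0 < f p x₀) :
    ∀ x ∈ s, ∀ p ≤ m, 0 < f p x := by
  have : PreconnectedSpace s := isPreconnected_iff_preconnectedSpace.1 hs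
  have hc : ∀ p ≤ m, Continuous fun x : s => f p x := fun p hp =>
    continuousOn_iff_continuous_domRestrict.1 (hf p hp)
  have hset : {x : s | ∀ p ≤ m, 0 < f p x} = {x : s | ∀ p ≤ m, 0 ≤ f p x} := by
    ext x
    exact ⟨fun h p hp => (h p hp).le, fun h => pos_of_nonneg_of_newton (f := fun p => f p x)
      (h0 x x.2) (hm x x.2) (hnewton x x.2) h⟩
  have hopen : IsOpen {x : s | ∀ p ≤ m, 0 < f p x} := by
    have := (Set.finite_Iic m).isOpen_biInter (f := fun p => {x : s | 0 < f p x})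
      fun p hp => isOpen_lt continuous_const (hc p hp)
    convert this using 1
    ext; simp
  have hclosed : IsClosed {x : s | ∀ p ≤ m, 0 ≤ f p x} := by
    have := isClosed_biInter (s := Set.Iic m) (f := fun p => {x : s | 0 ≤ f p x})
      fun p hp => isClosed_le continuous_const (hc p hp)
    convert this using 1
    ext; simp
  have huniv := IsClopen.eq_univ ⟨hset ▸ hclosed, hopen⟩ ⟨⟨x₀, hx₀⟩, hpos⟩
  intro x hx
  exact (huniv ▸ Set.mem_univ _ : (⟨x, hx⟩ : s) ∈ {x : s | ∀ p ≤ m, 0 < f p x})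

end Connected

/-! ### Sylvester's criterion for symmetric matrices. -/

section Sylvester

variable {d : ℕ} {S : Matrix (Fin (d + 1)) (Fin (d + 1)) ℝ}

theorem pTrace_pos_of_isPreconnected (hS : S.IsSymm) {I : Set ℝ} (hI : IsPreconnected I) {m : ℕ}
    (hm : ∀ s ∈ I, 0 < pTrace m (S + Matrix.single 0 0 s)) {s₀ : ℝ} (hs₀ : s₀ ∈ I)
    (hpos : ∀ p ≤ m, 0 < pTrace p (S + Matrix.single 0 0 s₀)) {s : ℝ} (hs : s ∈ I) :
    ∀ p ≤ m, 0 < pTrace p (S + Matrix.single 0 0 s) := by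
  refine pos_of_isPreconnected_of_newton hI (f := fun p s => pTrace p (S + Matrix.single 0 0 s))
    (fun p _ => ?_) (fun _ _ => pTrace_zero _) hm (fun s _ p => pTrace_mul_pTrace_neg ?_) hs₀ hpos
    s hs
  · refine ((continuous_pTrace p).comp (continuous_const.add ?_)).continuousOn
    exact continuous_matrix fun i j => by
      simp only [Matrix.single_apply]
      split_ifs <;> fun_prop
  · exact hS.add (by simp [Matrix.IsSymm, Matrix.transpose_single])

/-- A principal submatrix of order `d` of an `m`-positive matrix of order `d + 1` is
`(m - 1)`-positive. -/
theorem pTrace_submatrix_succ_pos (hS : S.IsSymm) {m : ℕ} (hpos : ∀ p ≤ m, 0 < pTrace p S) :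
    ∀ p < m, 0 < pTrace p (S.submatrix Fin.succ Fin.succ) := by
  intro p
  induction p using Nat.strong_induction_on with
  | _ p ih =>
    intro hp
    by_contra hcon
    push Not at hcon
    rcases p with _ | p
    · rw [pTrace_zero] at hcon
      linarith
    · have hb := ih p (by omega) (by omega)
      -- Here `p + 1` is the first failing order. The `(p+2)`-trace stays positive for `s ≤ 0`,
      -- whereas the chosen `s` is the zero of the `(p+1)`-trace.
      have hneg := pTrace_pos_of_isPreconnected (m := p + 2) hS isPreconnected_Iic
        (I := Set.Iic (0 : ℝ)) (fun s hs => ?_) (s₀ := 0) (Set.mem_Iic.2 le_rfl)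
        (fun q hq => ?_) (s := -(pTrace (p + 1) S / pTrace p (S.submatrix Fin.succ Fin.succ)))
        ?_ (p + 1) (by omega)
      · rw [pTrace_succ_add_single, neg_mul, div_mul_cancel₀ _ hb.ne'] at hneg
        linarith
      · rw [pTrace_succ_add_single]
        have := hpos (p + 2) (by omega)
        nlinarith [mul_nonneg_of_nonpos_of_nonpos (Set.mem_Iic.1 hs) hcon]
      · rw [Matrix.single_zero, add_zero]
        exact hpos q (by omega)
      · have := hpos (p + 1) (by omega)
        rw [Set.mem_Iic, neg_nonpos]
        positivity

/-- A symmetric matrix of order `d + 1` with a positive `m`-trace and an `(m - 1)`-positive principal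
submatrix of order `d` is `m`-positive. -/
theorem pTrace_pos_of_submatrix_succ (hS : S.IsSymm) {m : ℕ} (hm : 0 < pTrace m S)
    (hsub : ∀ p < m, 0 < pTrace p (S.submatrix Fin.succ Fin.succ)) :
    ∀ p ≤ m, 0 < pTrace p S := by
  -- For `s` above all `f p` with `1 ≤ p ≤ m`, the linear term in `s` dominates in each trace.
  set f : ℕ → ℝ := fun p => |pTrace p S| / pTrace (p - 1) (S.submatrix Fin.succ Fin.succ) with hf
  obtain ⟨s₀, hs₀⟩ := ((Set.finite_Icc 1 m).image f).bddAbove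
  have key : ∀ p ≤ m, 0 < pTrace p (S + Matrix.single 0 0 (max s₀ 0 + 1)) := by
    intro p hp
    rcases p with _ | p
    · rw [pTrace_zero]; exact one_pos
    · rw [pTrace_succ_add_single]
      have h1 := hs₀ (Set.mem_image_of_mem f (Set.mem_Icc.2 ⟨by omega, hp⟩ : p + 1 ∈ Set.Icc 1 m))
      have h2 := hsub p (by omega)
      have h3 : f (p + 1) < max s₀ 0 + 1 := by linarith [le_max_left s₀ 0]
      rw [hf] at h3
      simp only [Nat.add_sub_cancel] at h3
      rw [div_lt_iff₀ h2] at h3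
      linarith [neg_abs_le (pTrace (p + 1) S)]
  have := pTrace_pos_of_isPreconnected (m := m) hS isPreconnected_Ici (I := Set.Ici (0 : ℝ))
    (fun s hs => ?_) (s₀ := max s₀ 0 + 1) (Set.mem_Ici.2 (by positivity)) key
    (s := 0) (Set.mem_Ici.2 le_rfl)
  · simpa using this
  · rcases m with _ | m
    · rw [pTrace_zero]; exact one_pos
    · rw [pTrace_succ_add_single]
      have := mul_nonneg (Set.mem_Ici.1 hs) (hsub m (by omega)).le
      linarith

end Sylvester

/-! ### Bilinear forms in orthonormal bases of subspaces. -/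

section Frames

variable {E : Type*} [NormedAddCommGroup E] [InnerProductSpace ℝ E]

/-- The vectors `e 0, …, e (q - 1)` are an orthonormal basis of the `q`-dimensional subspace `L`. -/
structure IsFrame {q : ℕ} (L : Submodule ℝ E) (e : Fin q → E) : Prop where
  orthonormal : Orthonormal ℝ e
  mem : ∀ i, e i ∈ L
  finrank_eq : Module.finrank ℝ L = q

/-- The matrix of a bilinear form in a family of vectors. -/
noncomputable def formMatrix (H : E →L[ℝ] E →L[ℝ] ℝ) {q : ℕ} (e : Fin q → E) : Matrix (Fin q) (Fin q) ℝ :=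
  Matrix.of fun i j => H (e i) (e j)

theorem isSymm_formMatrix {H : E →L[ℝ] E →L[ℝ] ℝ} (hH : ∀ u v, H u v = H v u) {q : ℕ}
    (e : Fin q → E) : (formMatrix H e).IsSymm := by
  ext i j
  exact hH _ _

theorem formMatrix_sum_smul (H : E →L[ℝ] E →L[ℝ] ℝ) {q r : ℕ} (e : Fin q → E)
    (T : Matrix (Fin q) (Fin r) ℝ) :
    formMatrix H (fun j => ∑ i, T i j • e i) = T.transpose * formMatrix H e * T := by
  ext i j
  simp only [formMatrix, Matrix.of_apply, Matrix.mul_apply, Matrix.transpose_apply, map_sum,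
    map_smul, sum_apply, smul_apply, smul_eq_mul,
    Finset.sum_mul, Finset.mul_sum]
  exact Finset.sum_congr rfl fun x _ => Finset.sum_congr rfl fun y _ => by ring

theorem Submodule.exists_isFrame {q : ℕ} {L : Submodule ℝ E} [FiniteDimensional ℝ L]
    (h : Module.finrank ℝ L = q) : ∃ e : Fin q → E, IsFrame L e := by
  subst h
  refine ⟨fun i => (stdOrthonormalBasis ℝ L i : E), ?_, fun i => (stdOrthonormalBasis ℝ L i).2, rfl⟩
  exact (stdOrthonormalBasis ℝ L).orthonormal.comp_linearIsometry L.subtypeₗᵢ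

/-- The Gram–Schmidt process in terms of a square root `τ` of the inverse Gram matrix. -/
theorem isFrame_sum_smul {q : ℕ} {L : Submodule ℝ E} (hL : Module.finrank ℝ L = q) {a : Fin q → E}
    (ha : ∀ i, a i ∈ L) (hdet : (Matrix.gram ℝ a).det ≠ 0) {τ : Matrix (Fin q) (Fin q) ℝ}
    (hτ : τ * τ.transpose = (Matrix.gram ℝ a)⁻¹) :
    IsFrame L (fun j => ∑ i, τ i j • a i) := by
  refine ⟨?_, fun j => L.sum_mem fun i _ => L.smul_mem _ (ha i), hL⟩
  have h1 : τ.transpose * Matrix.gram ℝ a * τ = 1 := by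
    rw [mul_eq_one_comm, ← Matrix.mul_assoc, hτ]
    exact Matrix.nonsing_inv_mul _ (isUnit_iff_ne_zero.2 hdet)
  rw [orthonormal_iff_ite]
  intro i j
  rw [← Matrix.one_apply, ← h1]
  simp only [Matrix.mul_apply, Matrix.transpose_apply, Matrix.gram_apply, sum_inner, inner_sum,
    inner_smul_left, inner_smul_right, Finset.sum_mul, Finset.mul_sum, RCLike.conj_to_real]
  exact Finset.sum_congr rfl fun x _ => Finset.sum_congr rfl fun y _ => by ring

open scoped MatrixOrder in
theorem exists_mul_transpose_eq_inv_gram {q : ℕ} {a : Fin q → E}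
    (hdet : (Matrix.gram ℝ a).det ≠ 0) :
    ∃ τ : Matrix (Fin q) (Fin q) ℝ, τ * τ.transpose = (Matrix.gram ℝ a)⁻¹ := by
  have h := ((Matrix.posSemidef_gram ℝ a).posDef_iff_det_ne_zero.2 hdet).inv.posSemidef
  obtain ⟨B, hB⟩ := CStarAlgebra.nonneg_iff_eq_star_mul_self.1 h.nonneg
  refine ⟨B.transpose, ?_⟩
  rw [Matrix.transpose_transpose, hB, Matrix.star_eq_conjTranspose,
    Matrix.conjTranspose_eq_transpose_of_trivial]

variable [FiniteDimensional ℝ E]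

theorem IsFrame.sum_inner_smul {q : ℕ} {L : Submodule ℝ E} {e : Fin q → E}
    (he : IsFrame L e) {v : E} (hv : v ∈ L) : ∑ i, ⟪e i, v⟫ • e i = v := by
  have ho : Orthonormal ℝ (fun i => (⟨e i, he.mem i⟩ : L)) := by
    have := he.orthonormal
    rw [orthonormal_iff_ite] at this ⊢
    exact this
  have hs := ho.linearIndependent.span_eq_top_of_card_eq_finrank' (by simp [he.finrank_eq])
  have := (OrthonormalBasis.mk ho hs.ge).sum_repr' ⟨v, hv⟩
  simpa [Subtype.ext_iff] using this

/-- The transition matrix `T` is orthogonal, and the `p`-trace is cyclic. -/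
theorem IsFrame.pTrace_formMatrix_eq {q : ℕ} {L : Submodule ℝ E} {e e' : Fin q → E}
    (he : IsFrame L e) (he' : IsFrame L e') (H : E →L[ℝ] E →L[ℝ] ℝ) (p : ℕ) :
    pTrace p (formMatrix H e') = pTrace p (formMatrix H e) := by
  set T : Matrix (Fin q) (Fin q) ℝ := Matrix.of fun i j => ⟪e i, e' j⟫ with hT
  have h1 : e' = fun j => ∑ i, T i j • e i := by
    ext1 j
    exact (he.sum_inner_smul (he'.mem j)).symm
  have h2 : T.transpose * T = 1 := by
    ext i j
    have h := orthonormal_iff_ite.1 he'.orthonormal i j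
    rw [← he.sum_inner_smul (he'.mem j), inner_sum] at h
    simp only [inner_smul_right, real_inner_comm (e _) (e' i)] at h
    rw [Matrix.one_apply, ← h, Matrix.mul_apply]
    exact Finset.sum_congr rfl fun k _ => mul_comm _ _
  rw [h1, formMatrix_sum_smul, Matrix.mul_assoc, pTrace_mul_comm, Matrix.mul_assoc,
    mul_eq_one_comm.1 h2, Matrix.mul_one]

/-- The new vector is put in front so that the form on `L'` becomes the submatrix along `Fin.succ`.
-/
theorem IsFrame.exists_vecCons {q : ℕ} {L' L : Submodule ℝ E} (hle : L' ≤ L) {e : Fin q → E}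
    (he : IsFrame L' e) (hL : Module.finrank ℝ L = q + 1) :
    ∃ u : E, IsFrame L (Matrix.vecCons u e) := by
  have hne : L'ᗮ ⊓ L ≠ ⊥ := by
    intro h
    have := Submodule.sup_orthogonal_inf_of_hasOrthogonalProjection hle
    rw [h, sup_bot_eq] at this
    rw [← this, he.finrank_eq] at hL
    omega
  obtain ⟨v, hv, hv0⟩ := Submodule.exists_mem_ne_zero_of_ne_bot hne
  refine ⟨‖v‖⁻¹ • v, orthonormal_vecCons_iff.2 ⟨?_, fun i => ?_, he.orthonormal⟩, ?_, hL⟩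
  · rw [norm_smul, norm_inv, norm_norm, inv_mul_cancel₀ (norm_ne_zero_iff.2 hv0)]
  · rw [inner_smul_left, Submodule.inner_left_of_mem_orthogonal (he.mem i) hv.1, mul_zero]
  · refine Fin.cases ?_ fun i => ?_
    · exact L.smul_mem _ hv.2
    · exact hle (he.mem i)

theorem IsFrame.pTrace_pos_of_le {q : ℕ} {L' L : Submodule ℝ E} (hle : L' ≤ L) {e' : Fin q → E}
    (he' : IsFrame L' e') {e : Fin (q + 1) → E} (he : IsFrame L e) {H : E →L[ℝ] E →L[ℝ] ℝ}
    (hH : ∀ u v, H u v = H v u) {m : ℕ} (hpos : ∀ p ≤ m, 0 < pTrace p (formMatrix H e)) :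
    ∀ p < m, 0 < pTrace p (formMatrix H e') := by
  obtain ⟨u, hu⟩ := he'.exists_vecCons hle he.finrank_eq
  exact pTrace_submatrix_succ_pos (isSymm_formMatrix hH (Matrix.vecCons u e'))
    fun p hp => he.pTrace_formMatrix_eq hu H p ▸ hpos p hp

theorem IsFrame.pTrace_pos_of_ge {q : ℕ} {L' L : Submodule ℝ E} (hle : L' ≤ L) {e' : Fin q → E}
    (he' : IsFrame L' e') {e : Fin (q + 1) → E} (he : IsFrame L e) {H : E →L[ℝ] E →L[ℝ] ℝ}
    (hH : ∀ u v, H u v = H v u) {m : ℕ} (hm : 0 < pTrace m (formMatrix H e))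
    (hpos : ∀ p < m, 0 < pTrace p (formMatrix H e')) :
    ∀ p ≤ m, 0 < pTrace p (formMatrix H e) := by
  obtain ⟨u, hu⟩ := he'.exists_vecCons hle he.finrank_eq
  intro p hp
  rw [hu.pTrace_formMatrix_eq he]
  exact pTrace_pos_of_submatrix_succ (isSymm_formMatrix hH (Matrix.vecCons u e'))
    (he.pTrace_formMatrix_eq hu H m ▸ hm) hpos p hp

end Frames

/-! ### Local parametrizations. -/

section LocalParam

variable {E : Type*} [NormedAddCommGroup E] [InnerProductSpace ℝ E]

theorem fderiv_eq_sum_coordDeriv {d : ℕ} (X : EuclideanSpace ℝ (Fin d) → E)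
    (θ v : EuclideanSpace ℝ (Fin d)) : fderiv ℝ X θ v = ∑ i, v i • coordDeriv X i θ := by
  have := (EuclideanSpace.basisFun (Fin d) ℝ).sum_repr v
  simp only [EuclideanSpace.basisFun_repr, EuclideanSpace.basisFun_apply] at this
  conv_lhs => rw [← this]
  rw [map_sum]
  simp only [map_smul, coordDeriv]

theorem metricTensor_eq_gram {d : ℕ} (X : EuclideanSpace ℝ (Fin d) → E)
    (θ : EuclideanSpace ℝ (Fin d)) :
    metricTensor X θ = Matrix.gram ℝ fun i => coordDeriv X i θ := rfl

theorem det_metricTensor_ne_zero_iff {d : ℕ} {X : EuclideanSpace ℝ (Fin d) → E}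
    {θ : EuclideanSpace ℝ (Fin d)} :
    (metricTensor X θ).det ≠ 0 ↔ Function.Injective (fderiv ℝ X θ) := by
  rw [metricTensor_eq_gram, Matrix.det_gram_ne_zero_iff_linearIndependent]
  constructor
  · intro h
    rw [injective_iff_map_eq_zero]
    intro v hv
    rw [fderiv_eq_sum_coordDeriv] at hv
    ext i
    exact Fintype.linearIndependent_iff.1 h _ hv i
  · intro h
    rw [Fintype.linearIndependent_iff]
    intro c hc i
    have h0 : fderiv ℝ X θ (WithLp.toLp 2 c) = 0 := by
      rw [fderiv_eq_sum_coordDeriv]; exact hc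
    have := (injective_iff_map_eq_zero _).1 h _ h0
    simpa using congrArg (fun v : EuclideanSpace ℝ (Fin d) => v i) this

theorem IsLocalParam.contDiffAt {k : ℕ∞} {d : ℕ} {Γ : Set E} {M : E}
    {X : EuclideanSpace ℝ (Fin d) → E} {Θ : Set (EuclideanSpace ℝ (Fin d))}
    {θ₀ : EuclideanSpace ℝ (Fin d)} (h : IsLocalParam k Γ M X Θ θ₀) {θ : EuclideanSpace ℝ (Fin d)}
    (hθ : θ ∈ Θ) : ContDiffAt ℝ k X θ :=
  h.contDiffOn.contDiffAt (h.isOpen.mem_nhds hθ)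

theorem IsLocalParam.apply_mem {k : ℕ∞} {d : ℕ} {Γ : Set E} {M : E}
    {X : EuclideanSpace ℝ (Fin d) → E} {Θ : Set (EuclideanSpace ℝ (Fin d))}
    {θ₀ : EuclideanSpace ℝ (Fin d)} (h : IsLocalParam k Γ M X Θ θ₀) {θ : EuclideanSpace ℝ (Fin d)}
    (hθ : θ ∈ Θ) : X θ ∈ Γ := by
  obtain ⟨U, -, hU⟩ := h.image_eq
  exact (hU ▸ Set.mem_image_of_mem X hθ : X θ ∈ Γ ∩ U).1

theorem IsLocalParam.of_mem {k : ℕ∞} {d : ℕ} {Γ : Set E} {M : E}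
    {X : EuclideanSpace ℝ (Fin d) → E} {Θ : Set (EuclideanSpace ℝ (Fin d))}
    {θ₀ : EuclideanSpace ℝ (Fin d)} (h : IsLocalParam k Γ M X Θ θ₀) {θ : EuclideanSpace ℝ (Fin d)}
    (hθ : θ ∈ Θ) : IsLocalParam k Γ (X θ) X Θ θ :=
  ⟨h.isOpen, hθ, rfl, h.contDiffOn, h.nondegenerate, h.isEmbedding, h.image_eq⟩

/-- A local parametrization maps open subsets of its domain onto relatively open sets. -/
theorem IsLocalParam.exists_isOpen_image_eq {k : ℕ∞} {d : ℕ} {Γ : Set E} {M : E}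
    {X : EuclideanSpace ℝ (Fin d) → E} {Θ : Set (EuclideanSpace ℝ (Fin d))}
    {θ₀ : EuclideanSpace ℝ (Fin d)} (h : IsLocalParam k Γ M X Θ θ₀)
    {W : Set (EuclideanSpace ℝ (Fin d))} (hW : IsOpen W) (hWΘ : W ⊆ Θ) :
    ∃ U : Set E, IsOpen U ∧ X '' W = Γ ∩ U := by
  obtain ⟨U, hUo, hU⟩ := h.image_eq
  obtain ⟨U', hU'o, hU'⟩ := h.isEmbedding.isInducing.isOpen_iff.1
    (hW.preimage (continuous_subtype_val : Continuous (Subtype.val : Θ → _)))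
  refine ⟨U ∩ U', hUo.inter hU'o, ?_⟩
  have hiff : ∀ θ ∈ Θ, X θ ∈ U' ↔ θ ∈ W := fun θ hθ =>
    Set.ext_iff.1 hU' ⟨θ, hθ⟩
  ext x
  constructor
  · rintro ⟨θ, hθ, rfl⟩
    have : X θ ∈ Γ ∩ U := hU ▸ Set.mem_image_of_mem X (hWΘ hθ)
    exact ⟨this.1, this.2, (hiff θ (hWΘ hθ)).2 hθ⟩
  · rintro ⟨hxΓ, hxU, hxU'⟩
    obtain ⟨θ, hθ, rfl⟩ : x ∈ X '' Θ := hU ▸ ⟨hxΓ, hxU⟩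
    exact ⟨θ, (hiff θ hθ).1 hxU', rfl⟩

end LocalParam

/-! ### The inverse function theorem on an open set. -/

section Inverse

theorem exists_openPartialHomeomorph_contDiffOn_symm {E F : Type*} [NormedAddCommGroup E]
    [NormedSpace ℝ E] [CompleteSpace E] [NormedAddCommGroup F] [NormedSpace ℝ F]
    {k : ℕ∞} (hk : 1 ≤ k) {f : E → F} {s : Set E} (hs : IsOpen s) (hf : ContDiffOn ℝ k f s)
    {a : E} (ha : a ∈ s) {A : E ≃L[ℝ] F} (hA : HasFDerivAt f (A : E →L[ℝ] F) a) :
    ∃ e : OpenPartialHomeomorph E F, a ∈ e.source ∧ e.source ⊆ s ∧ (∀ x, e x = f x) ∧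
      ContDiffOn ℝ k e.symm e.target := by
  have hk1 : (1 : WithTop ℕ∞) ≤ k := by exact_mod_cast hk
  have hk0 : (k : WithTop ℕ∞) ≠ 0 := (zero_lt_one.trans_le hk1).ne'
  have hfa := hf.contDiffAt (hs.mem_nhds ha)
  -- Restricting to points with invertible derivative, an open condition, makes the inverse `C^k` on
  -- the whole target and not only at one point.
  set t : Set E := s ∩ fderiv ℝ f ⁻¹' Set.range ((↑) : (E ≃L[ℝ] F) → E →L[ℝ] F) with ht
  have hto : IsOpen t := (hf.continuousOn_fderiv_of_isOpen hs hk1).isOpen_inter_preimage hs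
    ContinuousLinearEquiv.isOpen
  refine ⟨(hfa.toOpenPartialHomeomorph f hA hk0).restrOpen t hto, ?_, ?_, fun x => rfl, ?_⟩
  · exact ⟨hfa.mem_toOpenPartialHomeomorph_source hA hk0, ha, A, hA.fderiv.symm⟩
  · intro x hx
    exact hx.2.1
  · intro y hy
    have hx := OpenPartialHomeomorph.map_target _ hy
    obtain ⟨hxs, B, hB⟩ := hx.2
    have hd := hf.contDiffAt (hs.mem_nhds hxs)
    refine (OpenPartialHomeomorph.contDiffAt_symm _ (f₀' := B) hy ?_ hd).contDiffWithinAt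
    rw [hB]
    exact (hd.differentiableAt hk0).hasFDerivAt

end Inverse

/-! ### A hypersurface as a graph over its tangent plane. -/

section LocalGraph

variable {E : Type*} [NormedAddCommGroup E] [InnerProductSpace ℝ E]

/-- In the neighbourhood `U` of `M`, the set `Γ` is the graph, in the direction `w`, of a function
`φ` of the class `C^k` which vanishes together with its differential at the origin. The function is
constant in the direction `w`. -/
structure IsLocalGraph (k : ℕ∞) (Γ : Set E) (M w : E) (φ : E → ℝ) (U V : Set E) : Prop where
  norm_eq_one : ‖w‖ = 1
  isOpen : IsOpen U
  mem : M ∈ U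
  isOpen_domain : IsOpen V
  zero_mem : 0 ∈ V
  contDiffOn : ContDiffOn ℝ k φ V
  apply_zero : φ 0 = 0
  fderiv_zero : fderiv ℝ φ 0 = 0
  apply_add_smul : ∀ (v : E) (t : ℝ), φ (v + t • w) = φ v
  mem_iff : ∀ x ∈ U, x ∈ Γ ↔ ⟪x - M, w⟫ = φ (x - M)

variable [FiniteDimensional ℝ E]

theorem exists_eq_smul_of_forall_inner_eq_zero {n : ℕ} (hE : Module.finrank ℝ E = n + 1)
    {A : EuclideanSpace ℝ (Fin n) →L[ℝ] E} (hA : Function.Injective A) {w : E} (hw : w ≠ 0)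
    (hwA : ∀ v, ⟪A v, w⟫ = 0) {x : E} (hx : ∀ v, ⟪A v, x⟫ = 0) : ∃ t : ℝ, t • w = x := by
  have hr : Module.finrank ℝ (LinearMap.range (A : EuclideanSpace ℝ (Fin n) →ₗ[ℝ] E)) = n := by
    rw [LinearMap.finrank_range_of_inj hA, finrank_euclideanSpace_fin]
  have hsum := (LinearMap.range (A : EuclideanSpace ℝ (Fin n) →ₗ[ℝ] E)).finrank_add_finrank_orthogonal
  have hmem : ∀ {y : E}, (∀ v, ⟪A v, y⟫ = 0) →
      y ∈ (LinearMap.range (A : EuclideanSpace ℝ (Fin n) →ₗ[ℝ] E))ᗮ := by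
    intro y hy
    rw [Submodule.mem_orthogonal]
    rintro _ ⟨v, rfl⟩
    exact hy v
  have heq := Submodule.eq_of_le_of_finrank_eq
    ((Submodule.span_singleton_le_iff_mem w _).2 (hmem hwA))
    (by rw [finrank_span_singleton hw]; omega)
  rw [← Submodule.mem_span_singleton, heq]
  exact hmem hx

theorem IsLocalParam.exists_isLocalGraph {k : ℕ∞} (hk : 1 ≤ k) {n : ℕ}
    (hE : Module.finrank ℝ E = n + 1) {Γ : Set E} {M : E} {X : EuclideanSpace ℝ (Fin n) → E}
    {Θ : Set (EuclideanSpace ℝ (Fin n))} {θ₀ : EuclideanSpace ℝ (Fin n)}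
    (h : IsLocalParam k Γ M X Θ θ₀) {w : E} (hw : ‖w‖ = 1)
    (hwX : ∀ v, ⟪fderiv ℝ X θ₀ v, w⟫ = 0) :
    ∃ (φ : E → ℝ) (U V : Set E), IsLocalGraph k Γ M w φ U V := by
  have hk0 : (k : WithTop ℕ∞) ≠ 0 :=
    (zero_lt_one.trans_le (by exact_mod_cast hk : (1 : WithTop ℕ∞) ≤ k)).ne'
  have hw0 : w ≠ 0 := by
    rintro rfl
    simp at hw
  set A := fderiv ℝ X θ₀ with hA
  have hAi : Function.Injective A := det_metricTensor_ne_zero_iff.1 (h.nondegenerate θ₀ h.mem)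
  -- `P` kills `w`, and `P ∘ X` has the invertible derivative `A* A` at `θ₀`. Thus `P x` serves as a
  -- coordinate on `Γ`, and a function of `P x` is constant along `w`.
  set P : E →L[ℝ] EuclideanSpace ℝ (Fin n) := A.adjoint with hP
  have hPw : P w = 0 := by
    refine ext_inner_right ℝ fun v => ?_
    rw [hP, ContinuousLinearMap.adjoint_inner_left, real_inner_comm, hwX, inner_zero_left]
  have hPA : Function.Injective (P ∘L A) := by
    rw [injective_iff_map_eq_zero]
    intro v hv
    refine (injective_iff_map_eq_zero A).1 hAi v (inner_self_eq_zero (𝕜 := ℝ).1 ?_)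
    rw [← ContinuousLinearMap.adjoint_inner_left]
    change ⟪(P ∘L A) v, v⟫ = 0
    rw [hv, inner_zero_left]
  set B : EuclideanSpace ℝ (Fin n) ≃L[ℝ] EuclideanSpace ℝ (Fin n) :=
    (LinearEquiv.ofInjectiveEndo (P ∘L A : _ →ₗ[ℝ] _) hPA).toContinuousLinearEquiv with hB
  have hXd : HasFDerivAt X A θ₀ := ((h.contDiffAt h.mem).differentiableAt hk0).hasFDerivAt
  have hFd : HasFDerivAt (fun θ => P (X θ)) (B : _ →L[ℝ] EuclideanSpace ℝ (Fin n)) θ₀ := by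
    have hBA : (B : _ →L[ℝ] EuclideanSpace ℝ (Fin n)) = P ∘L A := by
      ext1 v; rfl
    rw [hBA]
    exact P.hasFDerivAt.comp θ₀ hXd
  obtain ⟨e, hes, heΘ, heF, hec⟩ := exists_openPartialHomeomorph_contDiffOn_symm hk h.isOpen
    (P.contDiff.comp_contDiffOn h.contDiffOn) h.mem hFd
  replace heF : ∀ θ, e θ = P (X θ) := heF
  obtain ⟨U₀, hU₀o, hU₀⟩ := h.exists_isOpen_image_eq e.open_source heΘ
  have hPM : e.symm (P M) = θ₀ := by
    rw [← h.map_eq, ← heF, e.left_inv hes]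
  have hPMt : P M ∈ e.target := by
    rw [← h.map_eq, ← heF]
    exact e.map_source hes
  have hcont : Continuous fun v : E => P (M + v) := by fun_prop
  refine ⟨fun v => ⟪X (e.symm (P (M + v))) - M, w⟫, U₀ ∩ P ⁻¹' e.target,
    {v | P (M + v) ∈ e.target}, hw, hU₀o.inter (e.open_target.preimage P.continuous), ?_,
    e.open_target.preimage hcont, ?_, ?_, ?_, ?_, ?_, ?_⟩
  · have : M ∈ Γ ∩ U₀ := hU₀ ▸ ⟨θ₀, hes, h.map_eq⟩
    exact ⟨this.2, hPMt⟩
  · simpa using hPMt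
  · have h1 : ContDiffOn ℝ k (fun v => e.symm (P (M + v))) {v | P (M + v) ∈ e.target} :=
      hec.comp (P.contDiff.comp (contDiff_const.add contDiff_id)).contDiffOn fun v hv => hv
    have h2 : ContDiffOn ℝ k (fun v => X (e.symm (P (M + v)))) {v | P (M + v) ∈ e.target} :=
      h.contDiffOn.comp h1 fun v hv => heΘ (e.map_target hv)
    exact (h2.sub contDiffOn_const).inner ℝ contDiffOn_const
  · simp [hPM, h.map_eq]
  · have hd1 : DifferentiableAt ℝ (fun v : E => e.symm (P (M + v))) 0 := by
      have h1 : DifferentiableAt ℝ e.symm (P (M + 0)) := by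
        rw [add_zero]
        exact (hec.contDiffAt (e.open_target.mem_nhds hPMt)).differentiableAt hk0
      exact h1.comp (0 : E) (f := fun v : E => P (M + v)) (by fun_prop)
    have hd2 : HasFDerivAt (fun θ => ⟪X θ - M, w⟫) (0 : _ →L[ℝ] ℝ)
        (e.symm (P (M + 0))) := by
      rw [add_zero, hPM]
      have h1 : HasFDerivAt (fun θ => ⟪w, X θ - M⟫) (innerSL ℝ w ∘L A) θ₀ :=
        (innerSL ℝ w).hasFDerivAt.comp θ₀ (hXd.sub_const M)
      have h0 : innerSL ℝ w ∘L A = 0 := by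
        ext1 v
        change ⟪w, A v⟫ = 0
        rw [real_inner_comm, hwX]
      simp only [real_inner_comm w]
      exact h0 ▸ h1
    have h2 : HasFDerivAt (fun v => ⟪X (e.symm (P (M + v))) - M, w⟫) _ 0 :=
      hd2.comp (0 : E) (f := fun v : E => e.symm (P (M + v))) hd1.hasFDerivAt
    rw [h2.fderiv, ContinuousLinearMap.zero_comp]
  · intro v t
    simp only [map_add, map_smul, hPw, smul_zero, add_zero]
  · rintro x ⟨hxU, hxt⟩
    simp only [add_sub_cancel]
    constructor
    · intro hxΓ
      obtain ⟨θ, hθ, rfl⟩ : x ∈ X '' e.source := hU₀ ▸ ⟨hxΓ, hxU⟩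
      rw [← heF, e.left_inv hθ]
    · intro hx
      have hs := e.map_target hxt
      have hsub : ∀ v, ⟪A v, x - X (e.symm (P x))⟫ = 0 := by
        intro v
        rw [real_inner_comm, ← ContinuousLinearMap.adjoint_inner_left]
        change ⟪P _, v⟫ = 0
        rw [map_sub, ← heF (e.symm (P x)), e.right_inv hxt, sub_self, inner_zero_left]
      -- `x` and the point of `Γ` with the same `P`-coordinate differ by a multiple of `w`. Their
      -- heights along `w` agree, so they coincide.
      obtain ⟨t, ht⟩ := exists_eq_smul_of_forall_inner_eq_zero hE hAi hw0 hwX hsub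
      have ht0 : t = 0 := by
        have h1 : ⟪t • w, w⟫ = 0 := by
          rw [ht, ← sub_sub_sub_cancel_right x _ M, inner_sub_left, hx, sub_self]
        rwa [inner_smul_left, real_inner_self_eq_norm_sq, hw, one_pow, mul_one] at h1
      rw [ht0, zero_smul, eq_comm, sub_eq_zero] at ht
      rw [ht]
      exact h.apply_mem (heΘ hs)

end LocalGraph

/-! ### Normal sections as graphs, and their second forms. -/

section PlaneSection

open scoped Topology

variable {E : Type*} [NormedAddCommGroup E] [InnerProductSpace ℝ E]

/-- The section of `Γ` by the plane through `M` parallel to `L` and `w`. -/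
def planeSection (Γ : Set E) (M w : E) (L : Submodule ℝ E) : Set E :=
  Γ ∩ {x | x - M ∈ L ⊔ Submodule.span ℝ {w}}

theorem Submodule.mem_of_mem_sup_span_singleton {L : Submodule ℝ E} {w : E} (hw : ‖w‖ = 1)
    (hL : ∀ v ∈ L, ⟪v, w⟫ = 0) {x : E} (hx : x ∈ L ⊔ Submodule.span ℝ {w}) (hxw : ⟪x, w⟫ = 0) :
    x ∈ L := by
  obtain ⟨y, hy, z, hz, rfl⟩ := Submodule.mem_sup.1 hx
  obtain ⟨t, rfl⟩ := Submodule.mem_span_singleton.1 hz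
  rw [inner_add_left, hL y hy, zero_add, inner_smul_left, real_inner_self_eq_norm_sq, hw, one_pow,
    mul_one] at hxw
  have ht : t = 0 := hxw
  rw [ht, zero_smul, add_zero]
  exact hy

theorem Submodule.exists_linearIsometry_range_eq {q : ℕ} {L : Submodule ℝ E}
    [FiniteDimensional ℝ L] (h : Module.finrank ℝ L = q) :
    ∃ ι : EuclideanSpace ℝ (Fin q) →ₗᵢ[ℝ] E, (∀ z, ι z ∈ L) ∧ ∀ v ∈ L, ∃ z, ι z = v := by
  set b := (stdOrthonormalBasis ℝ L).reindex (finCongr h)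
  refine ⟨L.subtypeₗᵢ.comp b.repr.symm.toLinearIsometry, fun z => (b.repr.symm z).2, fun v hv =>
    ⟨b.repr ⟨v, hv⟩, ?_⟩⟩
  simp

theorem IsLocalGraph.exists_isLocalParam_planeSection {k : ℕ∞} (hk : 1 ≤ k) {Γ : Set E} {M w : E}
    {φ : E → ℝ} {U V : Set E} (h : IsLocalGraph k Γ M w φ U V) {q : ℕ} {L : Submodule ℝ E}
    [FiniteDimensional ℝ E] (hL : ∀ v ∈ L, ⟪v, w⟫ = 0) (hq : Module.finrank ℝ L = q) :
    ∃ (Y : EuclideanSpace ℝ (Fin q) → E) (Θ : Set (EuclideanSpace ℝ (Fin q))),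
      IsLocalParam k (planeSection Γ M w L) M Y Θ 0 ∧ ∀ v ∈ L, ∃ z, fderiv ℝ Y 0 z = v := by
  have hk0 : (k : WithTop ℕ∞) ≠ 0 :=
    (zero_lt_one.trans_le (by exact_mod_cast hk : (1 : WithTop ℕ∞) ≤ k)).ne'
  obtain ⟨ι, hιL, hιs⟩ := Submodule.exists_linearIsometry_range_eq hq
  set j : EuclideanSpace ℝ (Fin q) →L[ℝ] E := ι.toContinuousLinearMap with hj
  replace hιL : ∀ z, j z ∈ L := hιL
  replace hιs : ∀ v ∈ L, ∃ z, j z = v := hιs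
  set π : E →L[ℝ] EuclideanSpace ℝ (Fin q) := j.adjoint with hπ
  have hπj : ∀ z, π (j z) = z := by
    intro z
    refine ext_inner_right ℝ fun y => ?_
    rw [hπ, ContinuousLinearMap.adjoint_inner_left]
    exact ι.inner_map_map z y
  have hπw : π w = 0 := by
    refine ext_inner_right ℝ fun y => ?_
    rw [hπ, ContinuousLinearMap.adjoint_inner_left, inner_zero_left, real_inner_comm]
    exact hL _ (hιL y)
  -- The graph of `φ` over `L`. The map `x ↦ π (x - M)` is a left inverse of `Y`, which yields both
  -- nondegeneracy and the embedding property.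
  set Y : EuclideanSpace ℝ (Fin q) → E := fun z => M + j z + φ (j z) • w with hY
  have hYM : ∀ z, Y z - M = j z + φ (j z) • w := fun z => by
    simp only [hY]
    rw [add_assoc, add_sub_cancel_left]
  have hπY : ∀ z, π (Y z - M) = z := fun z => by
    rw [hYM, map_add, map_smul, hπw, smul_zero, add_zero, hπj]
  have hYw : ∀ z, ⟪Y z - M, w⟫ = φ (Y z - M) := fun z => by
    rw [hYM, h.apply_add_smul, inner_add_left, inner_smul_left, real_inner_self_eq_norm_sq,
      h.norm_eq_one, hL _ (hιL z)]
    simp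
  have hY0 : Y 0 = M := by simp [hY, h.apply_zero]
  have hVo : IsOpen (j ⁻¹' V) := h.isOpen_domain.preimage j.continuous
  have hYc : ContDiffOn ℝ k Y (j ⁻¹' V) := by
    refine (contDiff_const.add j.contDiff).contDiffOn.add (ContDiffOn.smul ?_ contDiffOn_const)
    exact h.contDiffOn.comp j.contDiff.contDiffOn fun z hz => hz
  set Θ := (j ⁻¹' V) ∩ Y ⁻¹' U with hΘ
  have hΘo : IsOpen Θ := hYc.continuousOn.isOpen_inter_preimage hVo h.isOpen
  have hYΘ : ContDiffOn ℝ k Y Θ := hYc.mono Set.inter_subset_left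
  have h0Θ : (0 : EuclideanSpace ℝ (Fin q)) ∈ Θ := by
    refine ⟨?_, ?_⟩
    · rw [Set.mem_preimage, map_zero]; exact h.zero_mem
    · rw [Set.mem_preimage, hY0]; exact h.mem
  have hYd : ∀ z ∈ Θ, HasFDerivAt Y (j + ((fderiv ℝ φ (j z)) ∘L j).smulRight w) z := by
    intro z hz
    have h1 : HasFDerivAt φ (fderiv ℝ φ (j z)) (j z) :=
      ((h.contDiffOn.contDiffAt (h.isOpen_domain.mem_nhds hz.1)).differentiableAt hk0).hasFDerivAt
    exact (j.hasFDerivAt.const_add M).add ((h1.comp z j.hasFDerivAt).smul_const w)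
  refine ⟨Y, Θ, ⟨hΘo, h0Θ, hY0, hYΘ, fun z hz => ?_, ?_, ?_⟩, fun v hv => ?_⟩
  · rw [det_metricTensor_ne_zero_iff, (hYd z hz).fderiv]
    refine Function.LeftInverse.injective (g := π) fun y => ?_
    simp [hπw, hπj]
  · refine Topology.IsEmbedding.of_comp (continuousOn_iff_continuous_domRestrict.1 hYΘ.continuousOn)
      (g := fun x => π (x - M)) (by fun_prop) ?_
    have : (fun x => π (x - M)) ∘ Θ.domRestrict Y = Subtype.val := funext fun z => hπY z
    rw [this]
    exact Topology.IsEmbedding.subtypeVal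
  · refine ⟨U ∩ (fun x => π (x - M)) ⁻¹' Θ,
      h.isOpen.inter (hΘo.preimage (by fun_prop)), ?_⟩
    ext x
    constructor
    · rintro ⟨z, hz, rfl⟩
      refine ⟨⟨(h.mem_iff _ hz.2).2 (hYw z), ?_⟩, hz.2, ?_⟩
      · rw [Set.mem_ofPred_eq, hYM]
        exact Submodule.add_mem_sup (hιL z)
          (Submodule.smul_mem _ _ (Submodule.mem_span_singleton_self w))
      · rw [Set.mem_preimage, hπY]; exact hz
    · rintro ⟨⟨hxΓ, hxL⟩, hxU, hxΘ⟩
      refine ⟨π (x - M), hxΘ, ?_⟩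
      obtain ⟨y, hy, y', hy', hxy⟩ := Submodule.mem_sup.1 hxL
      obtain ⟨t, rfl⟩ := Submodule.mem_span_singleton.1 hy'
      obtain ⟨z, rfl⟩ := hιs y hy
      have hx := (h.mem_iff x hxU).1 hxΓ
      have ht : t = φ (j z) := by
        rw [← hxy, h.apply_add_smul, inner_add_left, inner_smul_left, real_inner_self_eq_norm_sq,
          h.norm_eq_one, hL _ hy] at hx
        simpa using hx
      have hz : π (x - M) = z := by
        rw [← hxy, map_add, map_smul, hπw, smul_zero, add_zero]
        exact hπj z
      rw [hz, ← sub_left_inj (a := M), hYM, ← hxy, ht]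
  · obtain ⟨z, rfl⟩ := hιs v hv
    refine ⟨z, ?_⟩
    rw [(hYd 0 h0Θ).fderiv, map_zero, h.fderiv_zero]
    simp [hj]

theorem HasFDerivAt.apply_mem_of_eventually_mem {F : Type*} [NormedAddCommGroup F]
    [NormedSpace ℝ F] {f : F → E} {f' : F →L[ℝ] E} {a : F} (hf : HasFDerivAt f f' a)
    {K : Submodule ℝ E} [K.HasOrthogonalProjection] (h : ∀ᶠ x in 𝓝 a, f x ∈ K) (v : F) :
    f' v ∈ K := by
  rw [← K.orthogonal_orthogonal, Submodule.mem_orthogonal]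
  intro u hu
  have h1 : HasFDerivAt (fun x => ⟪u, f x⟫) (innerSL ℝ u ∘L f') a :=
    (innerSL ℝ u).hasFDerivAt.comp a hf
  have h2 : HasFDerivAt (fun x => ⟪u, f x⟫) (0 : F →L[ℝ] ℝ) a :=
    (hasFDerivAt_const 0 a).congr_of_eventuallyEq
      (h.mono fun x hx => Submodule.inner_left_of_mem_orthogonal hx hu)
  exact DFunLike.congr_fun (h1.unique h2) v

theorem IsLocalGraph.contDiffAt_zero {k : ℕ∞} {Γ : Set E} {M w : E} {φ : E → ℝ} {U V : Set E}
    (h : IsLocalGraph k Γ M w φ U V) : ContDiffAt ℝ k φ 0 :=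
  h.contDiffOn.contDiffAt (h.isOpen_domain.mem_nhds h.zero_mem)

theorem IsLocalGraph.fderiv_fderiv_comm {k : ℕ∞} (hk : 2 ≤ k) {Γ : Set E} {M w : E} {φ : E → ℝ}
    {U V : Set E} (h : IsLocalGraph k Γ M w φ U V) (u v : E) :
    fderiv ℝ (fderiv ℝ φ) 0 u v = fderiv ℝ (fderiv ℝ φ) 0 v u :=
  h.contDiffAt_zero.isSymmSndFDerivAt
    (by simpa using (WithTop.coe_le_coe.2 hk : (2 : WithTop ℕ∞) ≤ k)) u v

/-- The graph equation differentiated along `Y`. It is needed on a neighbourhood because it is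
differentiated once more in `secondForm_eq`. -/
theorem IsLocalGraph.eventually_inner_fderiv_eq {k : ℕ∞} (hk : 1 ≤ k) {Γ S : Set E} {M w : E}
    {φ : E → ℝ} {U V : Set E} (h : IsLocalGraph k Γ M w φ U V) (hS : S ⊆ Γ) {q : ℕ}
    {Y : EuclideanSpace ℝ (Fin q) → E} {Θ : Set (EuclideanSpace ℝ (Fin q))}
    {θ₀ : EuclideanSpace ℝ (Fin q)} (hY : IsLocalParam k S M Y Θ θ₀) :
    ∀ᶠ θ in 𝓝 θ₀, ∀ v, ⟪w, fderiv ℝ Y θ v⟫ = fderiv ℝ φ (Y θ - M) (fderiv ℝ Y θ v) := by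
  have hk0 : (k : WithTop ℕ∞) ≠ 0 :=
    (zero_lt_one.trans_le (by exact_mod_cast hk : (1 : WithTop ℕ∞) ≤ k)).ne'
  have hYc : ContinuousAt Y θ₀ := (hY.contDiffAt hY.mem).continuousAt
  have h1 : ∀ᶠ θ in 𝓝 θ₀, θ ∈ Θ ∧ Y θ ∈ U ∧ Y θ - M ∈ V := by
    refine Filter.Eventually.and (hY.isOpen.mem_nhds hY.mem) (Filter.Eventually.and ?_ ?_)
    · exact hYc.eventually_mem (h.isOpen.mem_nhds (hY.map_eq ▸ h.mem))
    · have h0 : Y θ₀ - M ∈ V := by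
        rw [hY.map_eq, sub_self]
        exact h.zero_mem
      exact (hYc.sub continuousAt_const).eventually_mem (h.isOpen_domain.mem_nhds h0)
  filter_upwards [h1.eventually_nhds] with θ hθ v
  have hθ' := hθ.self_of_nhds
  have hYd : HasFDerivAt (fun θ => Y θ - M) (fderiv ℝ Y θ) θ :=
    ((hY.contDiffAt hθ'.1).differentiableAt hk0).hasFDerivAt.sub_const M
  have h2 : HasFDerivAt (fun θ => ⟪w, Y θ - M⟫) (innerSL ℝ w ∘L fderiv ℝ Y θ) θ :=
    (innerSL ℝ w).hasFDerivAt.comp θ hYd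
  have h3 : HasFDerivAt (fun θ => φ (Y θ - M)) (fderiv ℝ φ (Y θ - M) ∘L fderiv ℝ Y θ) θ :=
    HasFDerivAt.comp θ (f := fun θ => Y θ - M) (((h.contDiffOn.contDiffAt
      (h.isOpen_domain.mem_nhds hθ'.2.2)).differentiableAt hk0).hasFDerivAt) hYd
  have h4 := h3.congr_of_eventuallyEq (f₁ := fun θ => ⟪w, Y θ - M⟫) (hθ.mono fun x hx => by
    change ⟪w, Y x - M⟫ = _
    rw [real_inner_comm]
    exact (h.mem_iff _ hx.2.1).1 (hS (hY.apply_mem hx.1)))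
  exact DFunLike.congr_fun (h2.unique h4) v

theorem IsLocalGraph.inner_fderiv_eq_zero {k : ℕ∞} (hk : 1 ≤ k) {Γ S : Set E} {M w : E}
    {φ : E → ℝ} {U V : Set E} (h : IsLocalGraph k Γ M w φ U V) (hS : S ⊆ Γ) {q : ℕ}
    {Y : EuclideanSpace ℝ (Fin q) → E} {Θ : Set (EuclideanSpace ℝ (Fin q))}
    {θ₀ : EuclideanSpace ℝ (Fin q)} (hY : IsLocalParam k S M Y Θ θ₀)
    (v : EuclideanSpace ℝ (Fin q)) : ⟪fderiv ℝ Y θ₀ v, w⟫ = 0 := by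
  have := (h.eventually_inner_fderiv_eq hk hS hY).self_of_nhds v
  rw [hY.map_eq, sub_self, h.fderiv_zero] at this
  rw [real_inner_comm, this]
  rfl

/-- In the twice differentiated graph equation the term with the second derivatives of `Y` on the
right drops out, since `φ` has zero differential at `0`. Only the Hessian of `φ` remains, the same
for all sections. -/
theorem IsLocalGraph.secondForm_eq {k : ℕ∞} (hk : 2 ≤ k) {Γ S : Set E} {M w : E}
    {φ : E → ℝ} {U V : Set E} (h : IsLocalGraph k Γ M w φ U V) (hS : S ⊆ Γ) {q : ℕ}
    {Y : EuclideanSpace ℝ (Fin q) → E} {Θ : Set (EuclideanSpace ℝ (Fin q))}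
    {θ₀ : EuclideanSpace ℝ (Fin q)} (hY : IsLocalParam k S M Y Θ θ₀) :
    secondForm Y w θ₀ = formMatrix (fderiv ℝ (fderiv ℝ φ) 0) fun i => coordDeriv Y i θ₀ := by
  have hk1 : 1 ≤ k := one_le_two.trans hk
  have hk2 : (2 : WithTop ℕ∞) ≤ k := WithTop.coe_le_coe.2 hk
  have hk0 : (k : WithTop ℕ∞) ≠ 0 := (two_pos.trans_le hk2).ne'
  ext i j
  have hYd : HasFDerivAt (fun θ => Y θ - M) (fderiv ℝ Y θ₀) θ₀ :=
    ((hY.contDiffAt hY.mem).differentiableAt hk0).hasFDerivAt.sub_const M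
  have hg : HasFDerivAt (coordDeriv Y i) (fderiv ℝ (coordDeriv Y i) θ₀) θ₀ := by
    have h1 : ContDiffAt ℝ 1 (fderiv ℝ Y) θ₀ :=
      (hY.contDiffAt hY.mem).fderiv_right (by simpa [one_add_one_eq_two] using hk2)
    exact ((h1.differentiableAt one_ne_zero).clm_apply
      (differentiableAt_const _)).hasFDerivAt
  have hH : HasFDerivAt (fderiv ℝ φ) (fderiv ℝ (fderiv ℝ φ) 0) (Y θ₀ - M) := by
    rw [hY.map_eq, sub_self]
    have h1 : ContDiffAt ℝ 1 (fderiv ℝ φ) 0 :=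
      h.contDiffAt_zero.fderiv_right (by simpa [one_add_one_eq_two] using hk2)
    exact (h1.differentiableAt one_ne_zero).hasFDerivAt
  have h1 : HasFDerivAt (fun θ => ⟪w, coordDeriv Y i θ⟫)
      (innerSL ℝ w ∘L fderiv ℝ (coordDeriv Y i) θ₀) θ₀ :=
    (innerSL ℝ w).hasFDerivAt.comp θ₀ hg
  have h2 := (HasFDerivAt.comp θ₀ (f := fun θ => Y θ - M) hH hYd).clm_apply hg
  have h3 := h2.congr_of_eventuallyEq (f₁ := fun θ => ⟪w, coordDeriv Y i θ⟫)
    ((h.eventually_inner_fderiv_eq hk1 hS hY).mono fun θ hθ => hθ _)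
  have h4 := DFunLike.congr_fun (h1.unique h3) (EuclideanSpace.single j 1)
  have h5 : ⟪w, coordDeriv (coordDeriv Y i) j θ₀⟫ = fderiv ℝ φ (Y θ₀ - M)
      (coordDeriv (coordDeriv Y i) j θ₀) +
      fderiv ℝ (fderiv ℝ φ) 0 (coordDeriv Y j θ₀) (coordDeriv Y i θ₀) := h4
  rw [hY.map_eq, sub_self, h.fderiv_zero, zero_apply, zero_add,
    h.fderiv_fderiv_comm hk] at h5
  change ⟪coordDeriv (coordDeriv Y i) j θ₀, w⟫ = _
  rw [real_inner_comm, h5]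
  rfl

end PlaneSection

/-! ### Curvatures of sections as traces of the Hessian. -/

section Curvature

variable {E : Type*} [NormedAddCommGroup E] [InnerProductSpace ℝ E] [FiniteDimensional ℝ E]
  {k : ℕ∞} {Γ : Set E} {M w : E} {φ : E → ℝ} {U V : Set E} {q : ℕ} {L : Submodule ℝ E}

theorem IsLocalGraph.coordDeriv_mem (hk : 1 ≤ k) (h : IsLocalGraph k Γ M w φ U V)
    (hL : ∀ v ∈ L, ⟪v, w⟫ = 0) {S : Set E} (hS : S ⊆ planeSection Γ M w L)
    {Y : EuclideanSpace ℝ (Fin q) → E} {Θ : Set (EuclideanSpace ℝ (Fin q))}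
    {θ₀ : EuclideanSpace ℝ (Fin q)} (hY : IsLocalParam k S M Y Θ θ₀)
    (v : EuclideanSpace ℝ (Fin q)) : fderiv ℝ Y θ₀ v ∈ L := by
  have hk0 : (k : WithTop ℕ∞) ≠ 0 :=
    (zero_lt_one.trans_le (by exact_mod_cast hk : (1 : WithTop ℕ∞) ≤ k)).ne'
  have hYd : HasFDerivAt (fun θ => Y θ - M) (fderiv ℝ Y θ₀) θ₀ :=
    ((hY.contDiffAt hY.mem).differentiableAt hk0).hasFDerivAt.sub_const M
  refine Submodule.mem_of_mem_sup_span_singleton h.norm_eq_one hL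
    (hYd.apply_mem_of_eventually_mem ?_ v)
    (h.inner_fderiv_eq_zero hk (hS.trans Set.inter_subset_left) hY v)
  exact Filter.mem_of_superset (hY.isOpen.mem_nhds hY.mem) fun θ hθ => (hS (hY.apply_mem hθ)).2

/-- The tangent vectors of the smaller section at `M` fill `L'`, and as tangent vectors of curves in
the larger section they lie in `L`. -/
theorem IsLocalGraph.le_of_planeSection_subset (hk : 1 ≤ k) (h : IsLocalGraph k Γ M w φ U V)
    {L' : Submodule ℝ E} (hL : ∀ v ∈ L, ⟪v, w⟫ = 0) (hL' : ∀ v ∈ L', ⟪v, w⟫ = 0)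
    (hsub : planeSection Γ M w L' ⊆ planeSection Γ M w L) : L' ≤ L := by
  intro v hv
  obtain ⟨Y, Θ, hY, hv'⟩ := h.exists_isLocalParam_planeSection hk hL' rfl
  obtain ⟨z, rfl⟩ := hv' v hv
  exact h.coordDeriv_mem hk hL hsub hY z

theorem IsLocalGraph.exists_isFrame_of_isCurvatureMatrix (hk : 2 ≤ k)
    (h : IsLocalGraph k Γ M w φ U V) (hL : ∀ v ∈ L, ⟪v, w⟫ = 0) (hq : Module.finrank ℝ L = q)
    {K : Matrix (Fin q) (Fin q) ℝ} (hK : IsCurvatureMatrix k (planeSection Γ M w L) w M K) :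
    ∃ e : Fin q → E, IsFrame L e ∧ K = formMatrix (fderiv ℝ (fderiv ℝ φ) 0) e := by
  obtain ⟨Y, Θ, θ₀, τ, hY, hτ, rfl⟩ := hK
  refine ⟨fun j => ∑ i, τ i j • coordDeriv Y i θ₀, isFrame_sum_smul hq
    (fun i => h.coordDeriv_mem (one_le_two.trans hk) hL subset_rfl hY _)
    (hY.nondegenerate θ₀ hY.mem) hτ, ?_⟩
  rw [formMatrix_sum_smul, h.secondForm_eq hk Set.inter_subset_left hY]

theorem IsLocalGraph.exists_isCurvatureMatrix (hk : 1 ≤ k) (h : IsLocalGraph k Γ M w φ U V)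
    (hL : ∀ v ∈ L, ⟪v, w⟫ = 0) (hq : Module.finrank ℝ L = q) :
    ∃ K : Matrix (Fin q) (Fin q) ℝ, IsCurvatureMatrix k (planeSection Γ M w L) w M K := by
  obtain ⟨Y, Θ, hY, -⟩ := h.exists_isLocalParam_planeSection hk hL hq
  obtain ⟨τ, hτ⟩ := exists_mul_transpose_eq_inv_gram (hY.nondegenerate 0 hY.mem)
  exact ⟨_, Y, Θ, 0, τ, hY, hτ, rfl⟩

theorem IsLocalGraph.pTrace_eq (hk : 2 ≤ k) (h : IsLocalGraph k Γ M w φ U V)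
    (hL : ∀ v ∈ L, ⟪v, w⟫ = 0) {e : Fin q → E} (he : IsFrame L e)
    {K : Matrix (Fin q) (Fin q) ℝ} (hK : IsCurvatureMatrix k (planeSection Γ M w L) w M K)
    (p : ℕ) : pTrace p K = pTrace p (formMatrix (fderiv ℝ (fderiv ℝ φ) 0) e) := by
  obtain ⟨e', he', rfl⟩ := h.exists_isFrame_of_isCurvatureMatrix hk hL he.finrank_eq hK
  exact he.pTrace_formMatrix_eq he' _ p

theorem IsLocalGraph.pCurvature_planeSection (hk : 2 ≤ k) (h : IsLocalGraph k Γ M w φ U V)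
    (hL : ∀ v ∈ L, ⟪v, w⟫ = 0) {e : Fin q → E} (he : IsFrame L e) (p : ℕ) :
    pCurvature k q (planeSection Γ M w L) w p M =
      pTrace p (formMatrix (fderiv ℝ (fderiv ℝ φ) 0) e) := by
  have hK := h.exists_isCurvatureMatrix (one_le_two.trans hk) hL he.finrank_eq
  rw [pCurvature, dif_pos hK]
  exact h.pTrace_eq hk hL he hK.choose_spec p

theorem IsLocalGraph.isMConvexAt_planeSection_iff (hk : 2 ≤ k) (h : IsLocalGraph k Γ M w φ U V)
    (hL : ∀ v ∈ L, ⟪v, w⟫ = 0) {e : Fin q → E} (he : IsFrame L e) (m : ℕ) :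
    IsMConvexAt k q (planeSection Γ M w L) w m M ↔
      ∀ p ≤ m, 0 < pTrace p (formMatrix (fderiv ℝ (fderiv ℝ φ) 0) e) := by
  constructor
  · rintro ⟨K, hK, -, hpos⟩ p hp
    rw [← h.pTrace_eq hk hL he hK]
    exact hpos p hp
  · intro hpos
    obtain ⟨K, hK⟩ := h.exists_isCurvatureMatrix (one_le_two.trans hk) hL he.finrank_eq
    refine ⟨K, hK, ?_, fun p hp => ?_⟩
    · obtain ⟨e', -, rfl⟩ := h.exists_isFrame_of_isCurvatureMatrix hk hL he.finrank_eq hK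
      exact isSymm_formMatrix (h.fderiv_fderiv_comm hk) e'
    · rw [h.pTrace_eq hk hL he hK]
      exact hpos p hp

end Curvature

/-! ### The pointwise criterion and continuity of the curvatures. -/

section Hypersurface

open scoped Topology

variable {E : Type*} [NormedAddCommGroup E] [InnerProductSpace ℝ E]
  {k : ℕ∞} {n : ℕ} {Γ : Set E} {ν : E → E} {M : E}

theorem planeSection_mono {w : E} {L' L : Submodule ℝ E} (h : L' ≤ L) :
    planeSection Γ M w L' ⊆ planeSection Γ M w L :=
  Set.inter_subset_inter_right _ fun _ hx => sup_le_sup_right h _ hx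

theorem IsLocalParam.fderiv_mem_tangentPlane {X : EuclideanSpace ℝ (Fin n) → E}
    {Θ : Set (EuclideanSpace ℝ (Fin n))} {θ₀ : EuclideanSpace ℝ (Fin n)}
    (h : IsLocalParam k Γ M X Θ θ₀) (v : EuclideanSpace ℝ (Fin n)) :
    fderiv ℝ X θ₀ v ∈ tangentPlane k n Γ M := by
  rw [fderiv_eq_sum_coordDeriv]
  exact Submodule.sum_mem _ fun i _ => Submodule.smul_mem _ _
    (Submodule.subset_span ⟨X, Θ, θ₀, i, h, rfl⟩)

/-- Allows continuity along `Γ` to be checked in the parameter. -/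
theorem IsLocalParam.nhdsWithin_le_map {X : EuclideanSpace ℝ (Fin n) → E}
    {Θ : Set (EuclideanSpace ℝ (Fin n))} {θ₀ : EuclideanSpace ℝ (Fin n)}
    (h : IsLocalParam k Γ M X Θ θ₀) : 𝓝[Γ] M ≤ Filter.map X (𝓝 θ₀) := by
  intro s hs
  obtain ⟨W, hWs, hWo, hθW⟩ := mem_nhds_iff.1
    (Filter.inter_mem (Filter.mem_map.1 hs) (h.isOpen.mem_nhds h.mem))
  obtain ⟨U, hUo, hU⟩ := h.exists_isOpen_image_eq hWo (hWs.trans Set.inter_subset_right)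
  have hM : M ∈ Γ ∩ U := hU ▸ ⟨θ₀, hθW, h.map_eq⟩
  refine Filter.mem_of_superset (Filter.inter_mem self_mem_nhdsWithin
    (mem_nhdsWithin_of_mem_nhds (hUo.mem_nhds hM.2))) ?_
  rw [← hU]
  rintro _ ⟨θ, hθ, rfl⟩
  exact (hWs hθ).1

/-- The curvatures in terms of the metric tensor and of the second quadratic form. -/
theorem pTrace_transpose_mul_secondForm_mul {d : ℕ} {X : EuclideanSpace ℝ (Fin d) → E}
    {w : E} {θ₀ : EuclideanSpace ℝ (Fin d)} {τ : Matrix (Fin d) (Fin d) ℝ}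
    (hτ : τ * τ.transpose = (metricTensor X θ₀)⁻¹) (p : ℕ) :
    pTrace p (τ.transpose * secondForm X w θ₀ * τ) =
      pTrace p ((metricTensor X θ₀)⁻¹ * secondForm X w θ₀) := by
  rw [pTrace_mul_comm, ← Matrix.mul_assoc, hτ]

/-- Working with `g⁻¹ b` avoids a continuous choice of the root `τ`. -/
theorem IsLocalParam.continuousAt_pTrace (hk : 2 ≤ k) {X : EuclideanSpace ℝ (Fin n) → E}
    {Θ : Set (EuclideanSpace ℝ (Fin n))} {θ₀ : EuclideanSpace ℝ (Fin n)}
    (h : IsLocalParam k Γ M X Θ θ₀) {w : EuclideanSpace ℝ (Fin n) → E}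
    (hw : ContinuousAt w θ₀) (p : ℕ) :
    ContinuousAt (fun θ => pTrace p ((metricTensor X θ)⁻¹ * secondForm X (w θ) θ)) θ₀ := by
  have hk2 : (2 : WithTop ℕ∞) ≤ k := WithTop.coe_le_coe.2 hk
  have hX1 : ContDiffAt ℝ 1 (fderiv ℝ X) θ₀ :=
    (h.contDiffAt h.mem).fderiv_right (by simpa [one_add_one_eq_two] using hk2)
  have hX2 : ∀ i, ContDiffAt ℝ 1 (coordDeriv X i) θ₀ := fun i => hX1.clm_apply contDiffAt_const
  have hX3 : ∀ i j, ContinuousAt (coordDeriv (coordDeriv X i) j) θ₀ := fun i j =>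
    (((hX2 i).fderiv_right (m := 0) (by simp)).clm_apply contDiffAt_const).continuousAt
  have hg : ContinuousAt (metricTensor X) θ₀ :=
    continuousAt_pi.2 fun i => continuousAt_pi.2 fun j =>
      (hX2 i).continuousAt.inner (𝕜 := ℝ) (hX2 j).continuousAt
  have hb : ContinuousAt (fun θ => secondForm X (w θ) θ) θ₀ :=
    continuousAt_pi.2 fun i => continuousAt_pi.2 fun j => (hX3 i j).inner (𝕜 := ℝ) hw
  have hgi : ContinuousAt (fun θ => (metricTensor X θ)⁻¹) θ₀ := by
    simp only [Matrix.inv_def, Ring.inverse_eq_inv']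
    exact (((continuous_id.matrix_det).continuousAt.comp hg).inv₀
      (h.nondegenerate θ₀ h.mem)).smul ((continuous_id.matrix_adjugate).continuousAt.comp hg)
  exact (continuous_pTrace p).continuousAt.comp (hgi.mul hb)

variable [FiniteDimensional ℝ E]

/-- The span runs over all parametrizations, so its dimension is bounded above by orthogonality to
`ν M`, and below by a single parametrization. -/
theorem finrank_tangentPlane (hE : Module.finrank ℝ E = n + 1) (hΓ : IsSmoothSurface k n Γ)
    (hν : IsUnitNormalField k n Γ ν) (hM : M ∈ Γ) :
    Module.finrank ℝ (tangentPlane k n Γ M) = n := by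
  obtain ⟨X, Θ, θ₀, hX⟩ := hΓ.2 M hM
  have hν0 : ν M ≠ 0 := by
    intro h
    have := hν.norm_eq_one M hM
    simp [h] at this
  apply le_antisymm
  · have h1 : tangentPlane k n Γ M ≤ (Submodule.span ℝ {ν M})ᗮ := fun v hv =>
      Submodule.mem_orthogonal_singleton_iff_inner_left.2 (hν.inner_eq_zero M hM v hv)
    have h2 := (Submodule.span ℝ {ν M}).finrank_add_finrank_orthogonal
    rw [finrank_span_singleton hν0] at h2
    have := Submodule.finrank_mono h1
    omega
  · have h1 : LinearMap.range (fderiv ℝ X θ₀ : EuclideanSpace ℝ (Fin n) →ₗ[ℝ] E) ≤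
        tangentPlane k n Γ M := by
      rintro _ ⟨v, rfl⟩
      exact hX.fderiv_mem_tangentPlane v
    have h2 := Submodule.finrank_mono h1
    rwa [LinearMap.finrank_range_of_inj
      (det_metricTensor_ne_zero_iff.1 (hX.nondegenerate θ₀ hX.mem)),
      finrank_euclideanSpace_fin] at h2

/-- The tangent plane and `ν M` span `E`. This lets `Γ` be treated as one of its own sections. -/
theorem planeSection_tangentPlane (hE : Module.finrank ℝ E = n + 1) (hΓ : IsSmoothSurface k n Γ)
    (hν : IsUnitNormalField k n Γ ν) (hM : M ∈ Γ) :
    planeSection Γ M (ν M) (tangentPlane k n Γ M) = Γ := by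
  have hν1 := hν.norm_eq_one M hM
  have hν0 : ν M ≠ 0 := by
    intro h
    simp [h] at hν1
  have heq : tangentPlane k n Γ M = (Submodule.span ℝ {ν M})ᗮ := by
    refine Submodule.eq_of_le_of_finrank_eq (fun v hv =>
      Submodule.mem_orthogonal_singleton_iff_inner_left.2 (hν.inner_eq_zero M hM v hv)) ?_
    have h2 := (Submodule.span ℝ {ν M}).finrank_add_finrank_orthogonal
    rw [finrank_span_singleton hν0] at h2
    rw [finrank_tangentPlane hE hΓ hν hM]
    omega
  refine Set.inter_eq_left.2 fun x _ => ?_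
  rw [Set.mem_ofPred_eq, heq, sup_comm, Submodule.sup_orthogonal_of_hasOrthogonalProjection]
  exact Submodule.mem_top

theorem exists_isLocalGraph (hk : 1 ≤ k) (hE : Module.finrank ℝ E = n + 1)
    (hΓ : IsSmoothSurface k n Γ) (hν : IsUnitNormalField k n Γ ν) (hM : M ∈ Γ) :
    ∃ (φ : E → ℝ) (U V : Set E), IsLocalGraph k Γ M (ν M) φ U V := by
  obtain ⟨X, Θ, θ₀, hX⟩ := hΓ.2 M hM
  exact hX.exists_isLocalGraph hk hE (hν.norm_eq_one M hM) fun v =>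
    hν.inner_eq_zero M hM _ (hX.fderiv_mem_tangentPlane v)

/-- All the curvatures of the plane sections of a hypersurface at `M` are given by the restrictions
of one quadratic form. -/
theorem exists_form_pCurvature_planeSection (hk : 2 ≤ k) (hE : Module.finrank ℝ E = n + 1)
    (hΓ : IsSmoothSurface k n Γ) (hν : IsUnitNormalField k n Γ ν) (hM : M ∈ Γ) :
    ∃ H : E →L[ℝ] E →L[ℝ] ℝ, (∀ u v, H u v = H v u) ∧
      ∀ (L : Submodule ℝ E), L ≤ tangentPlane k n Γ M → ∀ {q : ℕ} {e : Fin q → E}, IsFrame L e →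
        (∀ p, pCurvature k q (planeSection Γ M (ν M) L) (ν M) p M = pTrace p (formMatrix H e)) ∧
        (∀ K : Matrix (Fin q) (Fin q) ℝ,
          IsCurvatureMatrix k (planeSection Γ M (ν M) L) (ν M) M K → ∀ p,
          pTrace p K = pTrace p (formMatrix H e)) ∧
        ∀ m, IsMConvexAt k q (planeSection Γ M (ν M) L) (ν M) m M ↔
          ∀ p ≤ m, 0 < pTrace p (formMatrix H e) := by
  obtain ⟨φ, U, V, h⟩ := exists_isLocalGraph (one_le_two.trans hk) hE hΓ hν hM
  refine ⟨_, h.fderiv_fderiv_comm hk, fun L hL q e he => ?_⟩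
  have hL' : ∀ v ∈ L, ⟪v, ν M⟫ = 0 := fun v hv => hν.inner_eq_zero M hM v (hL hv)
  exact ⟨h.pCurvature_planeSection hk hL' he, fun _ hK => h.pTrace_eq hk hL' he hK,
    h.isMConvexAt_planeSection_iff hk hL' he⟩

theorem isMConvexAt_planeSection_iff (hk : 2 ≤ k) (hE : Module.finrank ℝ E = n + 1)
    (hΓ : IsSmoothSurface k n Γ) (hν : IsUnitNormalField k n Γ ν) (hM : M ∈ Γ)
    {L : Submodule ℝ E} (hL : L ≤ tangentPlane k n Γ M) {q : ℕ} (hq : Module.finrank ℝ L = q)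
    (m : ℕ) : IsMConvexAt k q (planeSection Γ M (ν M) L) (ν M) m M ↔
      ∀ p ≤ m, 0 < pCurvature k q (planeSection Γ M (ν M) L) (ν M) p M := by
  obtain ⟨H, -, h⟩ := exists_form_pCurvature_planeSection hk hE hΓ hν hM
  obtain ⟨e, he⟩ := Submodule.exists_isFrame hq
  simp only [(h L hL he).1, (h L hL he).2.2]

theorem isMConvexAt_iff (hk : 2 ≤ k) (hE : Module.finrank ℝ E = n + 1)
    (hΓ : IsSmoothSurface k n Γ) (hν : IsUnitNormalField k n Γ ν) (hM : M ∈ Γ) (m : ℕ) :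
    IsMConvexAt k n Γ (ν M) m M ↔ ∀ p ≤ m, 0 < pCurvature k n Γ (ν M) p M := by
  have := isMConvexAt_planeSection_iff hk hE hΓ hν hM le_rfl
    (finrank_tangentPlane hE hΓ hν hM) m
  rwa [planeSection_tangentPlane hE hΓ hν hM] at this

/-- The pointwise Sylvester criterion, necessity: the curvatures of a plane section of codimension
one. -/
theorem pCurvature_planeSection_pos_of_le (hk : 2 ≤ k) (hE : Module.finrank ℝ E = n + 1)
    (hΓ : IsSmoothSurface k n Γ) (hν : IsUnitNormalField k n Γ ν) (hM : M ∈ Γ)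
    {L' L : Submodule ℝ E} (hL : L ≤ tangentPlane k n Γ M) (hle : L' ≤ L) {q r : ℕ}
    (hr : Module.finrank ℝ L' = r) (hq : Module.finrank ℝ L = q) (hrq : q = r + 1) {m : ℕ}
    (hpos : ∀ p ≤ m, 0 < pCurvature k q (planeSection Γ M (ν M) L) (ν M) p M) :
    ∀ p < m, 0 < pCurvature k r (planeSection Γ M (ν M) L') (ν M) p M := by
  subst hrq
  obtain ⟨H, hH, h⟩ := exists_form_pCurvature_planeSection hk hE hΓ hν hM
  obtain ⟨e, he⟩ := Submodule.exists_isFrame hq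
  obtain ⟨e', he'⟩ := Submodule.exists_isFrame hr
  simp only [(h L hL he).1] at hpos
  simp only [(h L' (hle.trans hL) he').1]
  exact he'.pTrace_pos_of_le hle he hH hpos

/-- The pointwise Sylvester criterion, sufficiency. -/
theorem pCurvature_planeSection_pos_of_ge (hk : 2 ≤ k) (hE : Module.finrank ℝ E = n + 1)
    (hΓ : IsSmoothSurface k n Γ) (hν : IsUnitNormalField k n Γ ν) (hM : M ∈ Γ)
    {L' L : Submodule ℝ E} (hL : L ≤ tangentPlane k n Γ M) (hle : L' ≤ L) {q r : ℕ}
    (hr : Module.finrank ℝ L' = r) (hq : Module.finrank ℝ L = q) (hrq : q = r + 1) {m : ℕ}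
    (hm : 0 < pCurvature k q (planeSection Γ M (ν M) L) (ν M) m M)
    (hpos : ∀ p < m, 0 < pCurvature k r (planeSection Γ M (ν M) L') (ν M) p M) :
    ∀ p ≤ m, 0 < pCurvature k q (planeSection Γ M (ν M) L) (ν M) p M := by
  subst hrq
  obtain ⟨H, hH, h⟩ := exists_form_pCurvature_planeSection hk hE hΓ hν hM
  obtain ⟨e, he⟩ := Submodule.exists_isFrame hq
  obtain ⟨e', he'⟩ := Submodule.exists_isFrame hr
  simp only [(h L' (hle.trans hL) he').1] at hpos
  simp only [(h L hL he).1] at hm ⊢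
  exact he'.pTrace_pos_of_ge hle he hH hm hpos

theorem pCurvature_planeSection_zero (hk : 2 ≤ k) (hE : Module.finrank ℝ E = n + 1)
    (hΓ : IsSmoothSurface k n Γ) (hν : IsUnitNormalField k n Γ ν) (hM : M ∈ Γ)
    {L : Submodule ℝ E} (hL : L ≤ tangentPlane k n Γ M) {q : ℕ} (hq : Module.finrank ℝ L = q) :
    pCurvature k q (planeSection Γ M (ν M) L) (ν M) 0 M = 1 := by
  obtain ⟨H, -, h⟩ := exists_form_pCurvature_planeSection hk hE hΓ hν hM
  obtain ⟨e, he⟩ := Submodule.exists_isFrame hq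
  rw [(h L hL he).1, pTrace_zero]

theorem exists_pCurvature_eq_pTrace (hk : 2 ≤ k) (hE : Module.finrank ℝ E = n + 1)
    (hΓ : IsSmoothSurface k n Γ) (hν : IsUnitNormalField k n Γ ν) (hM : M ∈ Γ) :
    ∃ S : Matrix (Fin n) (Fin n) ℝ, S.IsSymm ∧
      (∀ p, pCurvature k n Γ (ν M) p M = pTrace p S) ∧
      ∀ K : Matrix (Fin n) (Fin n) ℝ, IsCurvatureMatrix k Γ (ν M) M K → ∀ p, pTrace p K = pTrace p S := by
  obtain ⟨H, hH, h⟩ := exists_form_pCurvature_planeSection hk hE hΓ hν hM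
  obtain ⟨e, he⟩ := Submodule.exists_isFrame (finrank_tangentPlane hE hΓ hν hM)
  have h' := h _ le_rfl he
  rw [planeSection_tangentPlane hE hΓ hν hM] at h'
  exact ⟨_, isSymm_formMatrix hH e, h'.1, h'.2.1⟩

theorem continuousOn_pCurvature (hk : 2 ≤ k) (hE : Module.finrank ℝ E = n + 1)
    (hΓ : IsSmoothSurface k n Γ) (hν : IsUnitNormalField k n Γ ν) (p : ℕ) :
    ContinuousOn (fun M => pCurvature k n Γ (ν M) p M) Γ := by
  intro M hM
  obtain ⟨X, Θ, θ₀, hX⟩ := hΓ.2 M hM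
  have hF : ∀ θ ∈ Θ, pCurvature k n Γ (ν (X θ)) p (X θ) =
      pTrace p ((metricTensor X θ)⁻¹ * secondForm X (ν (X θ)) θ) := by
    intro θ hθ
    obtain ⟨S, -, hS, hK⟩ := exists_pCurvature_eq_pTrace hk hE hΓ hν (hX.apply_mem hθ)
    obtain ⟨τ, hτ⟩ := exists_mul_transpose_eq_inv_gram (hX.nondegenerate θ hθ)
    rw [hS, ← pTrace_transpose_mul_secondForm_mul hτ]
    exact (hK _ ⟨X, Θ, θ, τ, hX.of_mem hθ, hτ, rfl⟩ p).symm
  have hΘ : Θ ∈ 𝓝 θ₀ := hX.isOpen.mem_nhds hX.mem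
  have hνX : ContinuousAt (fun θ => ν (X θ)) θ₀ := by
    have h1 : Filter.Tendsto X (𝓝 θ₀) (𝓝[Γ] (X θ₀)) :=
      tendsto_nhdsWithin_iff.2 ⟨(hX.contDiffAt hX.mem).continuousAt,
        Filter.mem_of_superset hΘ fun θ hθ => hX.apply_mem hθ⟩
    exact (hν.continuousOn (X θ₀) (hX.apply_mem hX.mem)).tendsto.comp h1
  have hc : ContinuousAt (fun θ => pCurvature k n Γ (ν (X θ)) p (X θ)) θ₀ :=
    (hX.continuousAt_pTrace hk hνX p).congr
      (Filter.mem_of_superset hΘ fun θ hθ => (hF θ hθ).symm)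
  have ht := Filter.tendsto_map'_iff (f := fun M => pCurvature k n Γ (ν M) p M) (g := X) |>.2 hc.tendsto
  rw [hX.map_eq] at ht
  exact ht.mono_left hX.nhdsWithin_le_map

/-- On a connected hypersurface with a positive `m`-curvature, the `m`-convexity at one point
implies the `m`-convexity. -/
theorem isMConvex_of_isMConvexAt (hk : 2 ≤ k) (hE : Module.finrank ℝ E = n + 1)
    (hΓ : IsSmoothSurface k n Γ) (hν : IsUnitNormalField k n Γ ν) {m : ℕ}
    (hpos : ∀ M ∈ Γ, 0 < pCurvature k n Γ (ν M) m M) (hM : M ∈ Γ)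
    (hconv : ∀ p ≤ m, 0 < pCurvature k n Γ (ν M) p M) : IsMConvex k n Γ ν m := by
  intro N hN
  rw [isMConvexAt_iff hk hE hΓ hν hN]
  refine pos_of_isPreconnected_of_newton hΓ.1.isPreconnected
    (f := fun p M => pCurvature k n Γ (ν M) p M)
    (fun p _ => continuousOn_pCurvature hk hE hΓ hν p) (fun x hx => ?_) hpos (fun x hx p => ?_)
    hM hconv N hN
  · obtain ⟨S, -, hS, -⟩ := exists_pCurvature_eq_pTrace hk hE hΓ hν hx
    exact (hS 0).trans (pTrace_zero S)
  · obtain ⟨S, hsymm, hS, -⟩ := exists_pCurvature_eq_pTrace hk hE hΓ hν hx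
    simp only [hS]
    exact pTrace_mul_pTrace_neg hsymm

end Hypersurface

/-! ### Chains of normal sections. -/

section Chains

variable {E : Type*} [NormedAddCommGroup E] [InnerProductSpace ℝ E] [FiniteDimensional ℝ E]
  {k : ℕ∞} {n : ℕ} {Γ : Set E} {ν : E → E} {M : E}

theorem Submodule.exists_flag {T : Submodule ℝ E} (hT : Module.finrank ℝ T = n) :
    ∃ L : ℕ → Submodule ℝ E, L 0 = T ∧ Antitone L ∧ ∀ j, Module.finrank ℝ (L j) = n - j := by
  obtain ⟨e, he⟩ := Submodule.exists_isFrame hT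
  have hli := he.orthonormal.linearIndependent
  set L : ℕ → Submodule ℝ E := fun j =>
    Submodule.span ℝ (Set.range fun i : Fin (n - j) => e (i.castLE (Nat.sub_le n j))) with hL
  have hfr : ∀ j, Module.finrank ℝ (L j) = n - j := fun j => by
    have := finrank_span_eq_card (hli.comp _ (Fin.castLE_injective (Nat.sub_le n j)))
    rwa [Fintype.card_fin] at this
  refine ⟨L, ?_, fun i j hij => ?_, hfr⟩
  · refine Submodule.eq_of_le_of_finrank_eq (Submodule.span_le.2 ?_) (by rw [hfr, hT, Nat.sub_zero])
    rintro _ ⟨i, rfl⟩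
    exact he.mem _
  · refine Submodule.span_mono ?_
    rintro _ ⟨l, rfl⟩
    exact ⟨l.castLE (by omega), rfl⟩

theorem IsNormalSectionChain.exists_submodules (hk : 1 ≤ k) (hE : Module.finrank ℝ E = n + 1)
    (hΓ : IsSmoothSurface k n Γ) (hν : IsUnitNormalField k n Γ ν) (hM : M ∈ Γ) {r : ℕ}
    {S : ℕ → Set E} (hS : IsNormalSectionChain k n Γ ν r M S) :
    ∃ L : ℕ → Submodule ℝ E, (∀ j ≤ r, L j ≤ tangentPlane k n Γ M) ∧
      (∀ j ≤ r, Module.finrank ℝ (L j) = n - j) ∧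
      (∀ j ≤ r, S j = planeSection Γ M (ν M) (L j)) ∧ ∀ j < r, L (j + 1) ≤ L j := by
  have hex : ∀ j, ∃ L : Submodule ℝ E, j ≤ r → L ≤ tangentPlane k n Γ M ∧
      Module.finrank ℝ L = n - j ∧ S j = planeSection Γ M (ν M) L := by
    intro j
    by_cases hj : j ≤ r
    · rcases Nat.eq_zero_or_pos j with rfl | hj0
      · exact ⟨tangentPlane k n Γ M, fun _ => ⟨le_rfl, finrank_tangentPlane hE hΓ hν hM,
          hS.zero.trans (planeSection_tangentPlane hE hΓ hν hM).symm⟩⟩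
      · obtain ⟨L, hL⟩ := hS.isNormalSection j hj0 hj
        exact ⟨L, fun _ => hL⟩
    · exact ⟨⊥, fun h => absurd h hj⟩
  choose L hL using hex
  obtain ⟨φ, U, V, h⟩ := exists_isLocalGraph hk hE hΓ hν hM
  have hperp : ∀ j ≤ r, ∀ v ∈ L j, inner ℝ v (ν M) = 0 := fun j hj v hv =>
    hν.inner_eq_zero M hM v ((hL j hj).1 hv)
  refine ⟨L, fun j hj => (hL j hj).1, fun j hj => (hL j hj).2.1, fun j hj => (hL j hj).2.2,
    fun j hj => h.le_of_planeSection_subset hk (hperp j hj.le) (hperp (j + 1) hj) ?_⟩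
  rw [← (hL j hj.le).2.2, ← (hL (j + 1) hj).2.2]
  exact hS.subset j hj

theorem isNormalSectionChain_planeSection (hE : Module.finrank ℝ E = n + 1)
    (hΓ : IsSmoothSurface k n Γ) (hν : IsUnitNormalField k n Γ ν) (hM : M ∈ Γ) (r : ℕ)
    {L : ℕ → Submodule ℝ E} (h0 : L 0 = tangentPlane k n Γ M) (hanti : Antitone L)
    (hL : ∀ j, Module.finrank ℝ (L j) = n - j) :
    IsNormalSectionChain k n Γ ν r M fun j => planeSection Γ M (ν M) (L j) where
  zero := by
    rw [h0]
    exact planeSection_tangentPlane hE hΓ hν hM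
  isNormalSection j _ _ := ⟨L j, h0 ▸ hanti (Nat.zero_le j), hL j, rfl⟩
  subset j _ := planeSection_mono (hanti (Nat.le_succ j))

theorem IsNormalSectionChain.pCurvature_pos (hk : 2 ≤ k) (hE : Module.finrank ℝ E = n + 1)
    (hΓ : IsSmoothSurface k n Γ) (hν : IsUnitNormalField k n Γ ν) (hM : M ∈ Γ) {m : ℕ}
    (hmn : m ≤ n) {S : ℕ → Set E} (hS : IsNormalSectionChain k n Γ ν (m - 1) M S)
    (hpos : ∀ p ≤ m, 0 < pCurvature k n Γ (ν M) p M) :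
    ∀ j ≤ m - 1, ∀ p ≤ m - j, 0 < pCurvature k (n - j) (S j) (ν M) p M := by
  obtain ⟨L, hLT, hLf, hSL, hLL⟩ := hS.exists_submodules (one_le_two.trans hk) hE hΓ hν hM
  intro j
  induction j with
  | zero =>
    intro _
    rw [hS.zero]
    exact hpos
  | succ j ih =>
    intro hj p hp
    have ih' := ih (by omega)
    rw [hSL j (by omega)] at ih'
    rw [hSL _ hj]
    exact pCurvature_planeSection_pos_of_le hk hE hΓ hν hM (hLT j (by omega)) (hLL j hj)
      (hLf _ hj) (hLf j (by omega)) (by omega) ih' p (by omega)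

theorem IsNormalSectionChain.pCurvature_pos_of_forall (hk : 2 ≤ k)
    (hE : Module.finrank ℝ E = n + 1) (hΓ : IsSmoothSurface k n Γ)
    (hν : IsUnitNormalField k n Γ ν) (hM : M ∈ Γ) {m : ℕ} (hm : 1 ≤ m) (hmn : m ≤ n)
    {S : ℕ → Set E} (hS : IsNormalSectionChain k n Γ ν (m - 1) M S)
    (hpos : ∀ j ≤ m - 1, 0 < pCurvature k (n - j) (S j) (ν M) (m - j) M) :
    ∀ p ≤ m, 0 < pCurvature k n Γ (ν M) p M := by
  obtain ⟨L, hLT, hLf, hSL, hLL⟩ := hS.exists_submodules (one_le_two.trans hk) hE hΓ hν hM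
  have key : ∀ j ≤ m - 1, ∀ p ≤ m - j, 0 < pCurvature k (n - j) (S j) (ν M) p M := by
    intro j hj
    induction hj using Nat.decreasingInduction with
    | self =>
      -- At the bottom, `j = m - 1`, only the orders `0` and `1` occur: the former is trivial, the
      -- latter is the hypothesis.
      intro p hp
      rcases Nat.eq_zero_or_pos p with rfl | hp0
      · rw [hSL _ le_rfl, pCurvature_planeSection_zero hk hE hΓ hν hM (hLT _ le_rfl) (hLf _ le_rfl)]
        exact one_pos
      · obtain rfl : p = m - (m - 1) := by omega
        exact hpos _ le_rfl
    | of_succ j hj ih =>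
      have hj' := hpos j hj.le
      rw [hSL _ hj] at ih
      rw [hSL j hj.le] at hj' ⊢
      exact pCurvature_planeSection_pos_of_ge hk hE hΓ hν hM (hLT j hj.le) (hLL j hj)
        (hLf _ hj) (hLf j hj.le) (by omega) hj' fun p hp => ih p (by omega)
  have := key 0 (Nat.zero_le _)
  rwa [hS.zero] at this

end Chains

/-! ### The geometric criterion. -/

theorem theorem5p15 (k : ℕ∞) (hk : 2 ≤ k) (n m : ℕ) (hm : 1 ≤ m) (hmn : m ≤ n)
    (Γ : Set (EuclideanSpace ℝ (Fin (n + 1)))) (hΓ : IsSmoothSurface k n Γ)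
    (ν : EuclideanSpace ℝ (Fin (n + 1)) → EuclideanSpace ℝ (Fin (n + 1)))
    (hν : IsUnitNormalField k n Γ ν)
    (hpos : ∀ M ∈ Γ, 0 < pCurvature k n Γ (ν M) m M) :
    (IsMConvex k n Γ ν m ↔
      ∃ M₀ ∈ Γ, ∃ S : Set (EuclideanSpace ℝ (Fin (n + 1))),
        IsNormalSection k n Γ ν (n - 1) M₀ S ∧ IsMConvexAt k (n - 1) S (ν M₀) (m - 1) M₀) ∧
    (IsMConvex k n Γ ν m ↔
      ∃ M₀ ∈ Γ, ∃ S : ℕ → Set (EuclideanSpace ℝ (Fin (n + 1))),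
        IsNormalSectionChain k n Γ ν (m - 1) M₀ S ∧
        ∀ j, 1 ≤ j → j ≤ m - 1 → 0 < pCurvature k (n - j) (S j) (ν M₀) (m - j) M₀) ∧
    (IsMConvex k n Γ ν m →
      ∀ M₀ ∈ Γ,
        (∀ S : Set (EuclideanSpace ℝ (Fin (n + 1))),
          IsNormalSection k n Γ ν (n - 1) M₀ S →
            IsMConvexAt k (n - 1) S (ν M₀) (m - 1) M₀) ∧
        (∀ S : ℕ → Set (EuclideanSpace ℝ (Fin (n + 1))),
          IsNormalSectionChain k n Γ ν (m - 1) M₀ S →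
            ∀ j, 1 ≤ j → j ≤ m - 1 →
              0 < pCurvature k (n - j) (S j) (ν M₀) (m - j) M₀)) := by
  have hE : Module.finrank ℝ (EuclideanSpace ℝ (Fin (n + 1))) = n + 1 := finrank_euclideanSpace_fin
  have hn : n = n - 1 + 1 := by omega
  have hnec : IsMConvex k n Γ ν m → ∀ M₀ ∈ Γ,
      (∀ S, IsNormalSection k n Γ ν (n - 1) M₀ S →
        IsMConvexAt k (n - 1) S (ν M₀) (m - 1) M₀) ∧
      (∀ S, IsNormalSectionChain k n Γ ν (m - 1) M₀ S →
        ∀ j, 1 ≤ j → j ≤ m - 1 → 0 < pCurvature k (n - j) (S j) (ν M₀) (m - j) M₀) := by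
    intro hconv M₀ hM₀
    have hM₀pos := (isMConvexAt_iff hk hE hΓ hν hM₀ m).1 (hconv M₀ hM₀)
    refine ⟨?_, fun S hS j _ hj =>
      hS.pCurvature_pos hk hE hΓ hν hM₀ hmn hM₀pos j hj (m - j) le_rfl⟩
    rintro S ⟨L, hLT, hLf, rfl⟩
    rw [← planeSection_tangentPlane hE hΓ hν hM₀] at hM₀pos
    refine (isMConvexAt_planeSection_iff hk hE hΓ hν hM₀ hLT hLf (m - 1)).2 fun p hp => ?_
    exact pCurvature_planeSection_pos_of_le hk hE hΓ hν hM₀ le_rfl hLT hLf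
      (finrank_tangentPlane hE hΓ hν hM₀) hn hM₀pos p (by omega)
  obtain ⟨M₁, hM₁⟩ := hΓ.1.nonempty
  -- A flag in one tangent plane supplies the section and the chain for both existence claims.
  obtain ⟨L, hL0, hLanti, hLf⟩ := Submodule.exists_flag (finrank_tangentPlane hE hΓ hν hM₁)
  refine ⟨⟨fun hconv => ?_, ?_⟩, ⟨fun hconv => ?_, ?_⟩, hnec⟩
  · have hS : IsNormalSection k n Γ ν (n - 1) M₁ (planeSection Γ M₁ (ν M₁) (L 1)) :=
      ⟨L 1, hL0 ▸ hLanti zero_le_one, hLf 1, rfl⟩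
    exact ⟨M₁, hM₁, _, hS, (hnec hconv M₁ hM₁).1 _ hS⟩
  · rintro ⟨M₀, hM₀, _, ⟨L', hLT, hLf', rfl⟩, hS⟩
    refine isMConvex_of_isMConvexAt hk hE hΓ hν hpos hM₀ ?_
    have hM₀pos := hpos M₀ hM₀
    rw [← planeSection_tangentPlane hE hΓ hν hM₀] at hM₀pos
    have := pCurvature_planeSection_pos_of_ge hk hE hΓ hν hM₀ le_rfl hLT hLf'
      (finrank_tangentPlane hE hΓ hν hM₀) hn hM₀pos fun p hp =>
        (isMConvexAt_planeSection_iff hk hE hΓ hν hM₀ hLT hLf' (m - 1)).1 hS p (by omega)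
    rwa [planeSection_tangentPlane hE hΓ hν hM₀] at this
  · have hS := isNormalSectionChain_planeSection hE hΓ hν hM₁ (m - 1) hL0 hLanti hLf
    exact ⟨M₁, hM₁, _, hS, (hnec hconv M₁ hM₁).2 _ hS⟩
  · rintro ⟨M₀, hM₀, S, hS, hSpos⟩
    refine isMConvex_of_isMConvexAt hk hE hΓ hν hpos hM₀
      (hS.pCurvature_pos_of_forall hk hE hΓ hν hM₀ hm hmn fun j hj => ?_)
    -- The chain inequalities start at `j = 1`; the case `j = 0` is the positivity of the
    -- `m`-curvature of `Γ`.
    rcases Nat.eq_zero_or_pos j with rfl | hj0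
    · rw [hS.zero]
      exact hpos M₀ hM₀
    · exact hSpos j hj0 hj
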